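/- Consider $K$ arms and a horizon $T$. Pulling arm $k\in\{1,\dots,K\}$ at epoch $t$ yields the reward $Y_{k,t}=\mu_{k,t}+\epsilon_t$, where the deterministic sequence $(\mu_{k,t})_t$ is real and periodic in $t$ with minimal period $T_k\ge 1$. Write $\mu_{k,t}=\sum_{j=0}^{T_k-1}b_{k,j}e^{2\pi i jt/T_k}$ and let $$B_k=\sup\{|b_{k,j}|:|b_{k,j}|>0,\ 0\le j<T_k\},\qquad b_k=\inf\{|b_{k,j}|:|b_{k,j}|>0,\ 0\le j<T_k\}$$ (with $B_k=0$, $b_k=+\infty$ if all $b_{k,j}$ vanish). Let $n,g$ be natural numbers, $H>0$, $\sigma>0$, $nK\le T$, and put $$A_j=\sup_{\nu\in[j,j+1]}\frac{|\sin(\pi\nu)|}{\pi\nu},\quad U_1=\sum_{j=0}^{\lfloor (n-2g-1)/(4g)\rfloor}A_{(2j+1)g},\quad U_2=\sum_{j=1}^{\lfloor (n-1)/(4g)\rfloor}A_{2jg-1},\quad \bar\epsilon=\frac{2\sigma H}{1-\pi/24}\sqrt{\frac{\log n}{n}}.$$ **Algorithm.** Arm $k$ is pulled at the $n$ epochs $n(k-1)+1,\dots,nk$.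 For each $k$, compute the periodogram $|\tilde y_k(v)|=\bigl|\frac1n\sum_{s=n(k-1)+1}^{nk}Y_{k,s}e^{-2\pi i vs}\bigr|$, $v\in[0,1/2]$, the threshold $\tau_k=\bar\epsilon+\frac{\pi U_1}{1-\pi U_2}\bigl(\bar\epsilon+\sup_{v\in[0,1/2]}|\tilde y_k(v)|\bigr)$, the candidate set $\mathcal F=\{j_1/j_2: j_1,j_2\in\mathbb N,\ 1\le j_1<j_2<\frac{n}{2g}\}$ and the domain $\mathcal D=\{v:\frac gn\le v\le\frac12,\ |\tilde y_k(v)|>\tau_k\}$. While $\mathcal D\ne\emptyset$, in the $i$-th pass take a maximizer $v_i^*$ of $|\tilde y_k|$ over $\mathcal D$ and an element $\hat v_i$ of $\mathcal F$ closest to $v_i^*$, and replace $\mathcal D$ by $\mathcal D\setminus(\hat v_i-\frac gn,\hat v_i+\frac gn)$. When $\mathcal D=\emptyset$, return $\hat T_k$, the least common multiple of $\hat v_1^{-1},\hat v_2^{-1},\dots$, that is, the least positive integer that is an integer multiple of every $\hat v_i^{-1}$ (so $\hat T_k=1$ if there are none). **Theorem.** Assume: 1. $\epsilon_1,\dots,\epsilon_T$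 are independent and sub-Gaussian with parameter $\sigma$: $\mathbb E[e^{\lambda\epsilon_t}]\le e^{\sigma^2\lambda^2/2}$ for all $\lambda\in\mathbb R$ (hence $\mathbb E[\epsilon_t]=0$ and $\mathbb P(|\epsilon_t|>x)\le 2e^{-x^2/(2\sigma^2)}$ for $x>0$); 2. $T>4K$, $g\ge\max\{2,\sqrt n\}$ and $T_k<\frac{n}{2g}$ for every $k$; 3. for every $k$, $$b_k\ \ge\ \Bigl(\frac{2\pi U_1}{1-\pi U_2}+2\Bigr)\bar\epsilon+\max\Bigl\{\frac{8\pi}{3}U_2,\ \frac{\pi U_1}{1-\pi U_2}\max\{\pi U_1,\pi U_2+1\}+\pi U_2\Bigr\}B_k .$$ Let $\Lambda$ be the event that, for every arm $k$, the algorithm terminates and returns $\hat T_k=T_k$, however ties in its choices are broken. Then $$\mathbb P(\Lambda)\ \ge\ 1-\frac{48K}{n^{H^2-1}}-\frac{200K}{n^{0.867H^2-1}}-\frac{200K}{n^{0.694H^2-1}} .$$ More precisely, $\Lambda$ contains a measurable event whose probability is at least the right-hand side. -/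

import Mathlib

open scoped NNReal
open MeasureTheory ProbabilityTheory

namespace PeriodicBandit

noncomputable section

/-! ### Mean rewards and their Fourier coefficients -/

/-- `p` is the (minimal) period of the sequence of mean rewards `m 1, m 2, …` of an arm. -/
def IsMinimalPeriod (m : ℕ → ℝ) (p : ℕ) : Prop :=
  IsLeast {q : ℕ | 0 < q ∧ Function.Periodic m q} p

/-- The coefficient `b_j` in the representation
`m t = ∑_{j=0}^{p-1} b_j exp (2 π i (j / p) t)` of a sequence `m` of period `p`
(the representation itself is `fourierCoeff_representation` below). -/
def fourierCoeff (m : ℕ → ℝ) (p j : ℕ) : ℂ :=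
  (1 / (p : ℂ)) * ∑ t ∈ Finset.range p,
    (m t : ℂ) * Complex.exp (-(2 * Real.pi * Complex.I * (j / p) * t))

theorem fourierCoeff_representation (m : ℕ → ℝ) (p : ℕ) (hp : 0 < p)
    (hm : Function.Periodic m p) (t : ℕ) :
    (m t : ℂ) = ∑ j ∈ Finset.range p,
      fourierCoeff m p j * Complex.exp (2 * Real.pi * Complex.I * (j / p) * t) := by
  have hpC : (p : ℂ) ≠ 0 := by exact_mod_cast hp.ne'
  have hgeo : ∀ s ∈ Finset.range p,
      ∑ j ∈ Finset.range p, Complex.exp (-(2 * Real.pi * Complex.I * (j / p) * s)) *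
        Complex.exp (2 * Real.pi * Complex.I * (j / p) * t) = if s = t % p then (p : ℂ) else 0 := by
    intro s hs
    set x := Complex.exp (2 * Real.pi * Complex.I * (((t : ℂ) - s) / p)) with hx
    have hterm : ∀ j : ℕ, Complex.exp (-(2 * Real.pi * Complex.I * (j / p) * s)) *
        Complex.exp (2 * Real.pi * Complex.I * (j / p) * t) = x ^ j := by
      intro j
      rw [← Complex.exp_add, hx, ← Complex.exp_nat_mul]
      congr 1
      ring
    have hxp : x ^ p = 1 := by
      rw [hx, ← Complex.exp_nat_mul, Complex.exp_eq_one_iff]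
      refine ⟨(t : ℤ) - s, ?_⟩
      push_cast
      field_simp
    have hx1 : x = 1 ↔ s = t % p := by
      rw [hx, Complex.exp_eq_one_iff]
      have hs' : s % p = s := Nat.mod_eq_of_lt (Finset.mem_range.mp hs)
      constructor
      · rintro ⟨c, hc⟩
        have h2 : (2 * Real.pi * Complex.I : ℂ) ≠ 0 := Complex.two_pi_I_ne_zero
        have h3 : ((t : ℂ) - s) / p = c := by
          apply mul_left_cancel₀ h2
          rw [hc]
          ring
        rw [div_eq_iff hpC] at h3
        have h4 : (t : ℤ) - s = c * p := by exact_mod_cast h3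
        have h5 : s ≡ t [MOD p] := (Nat.modEq_iff_dvd).mpr ⟨c, by rw [h4]; ring⟩
        rw [← hs']
        exact h5
      · intro h
        refine ⟨((t / p : ℕ) : ℤ), ?_⟩
        have h6 : (t : ℂ) = p * ((t / p : ℕ) : ℂ) + s := by
          rw [h]
          exact_mod_cast (Nat.div_add_mod t p).symm
        rw [h6, Int.cast_natCast]
        field_simp
        ring
    simp_rw [hterm]
    split_ifs with h
    · simp [hx1.mpr h]
    · have h7 : x ≠ 1 := fun h' => h (hx1.mp h')
      rw [geom_sum_eq h7, hxp]
      simp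
  have hswap : ∑ j ∈ Finset.range p,
      fourierCoeff m p j * Complex.exp (2 * Real.pi * Complex.I * (j / p) * t) =
      (1 / (p : ℂ)) * ∑ s ∈ Finset.range p, (m s : ℂ) *
        ∑ j ∈ Finset.range p, Complex.exp (-(2 * Real.pi * Complex.I * (j / p) * s)) *
          Complex.exp (2 * Real.pi * Complex.I * (j / p) * t) := by
    simp only [fourierCoeff, Finset.mul_sum, Finset.sum_mul]
    rw [Finset.sum_comm]
    refine Finset.sum_congr rfl fun s _ => Finset.sum_congr rfl fun j _ => ?_
    ring
  rw [hswap, Finset.sum_congr rfl fun s hs => by rw [hgeo s hs]]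
  have hmod : t % p ∈ Finset.range p := Finset.mem_range.mpr (Nat.mod_lt t hp)
  simp only [mul_ite, mul_zero, Finset.sum_ite_eq', hmod, if_true]
  rw [hm.map_mod_nat t]
  field_simp

/-- The set of magnitudes `|b_j| > 0` of the present frequencies `j / p`, `0 ≤ j < p`. -/
def presentMagnitudes (m : ℕ → ℝ) (p : ℕ) : Set ℝ :=
  {a | 0 < a ∧ ∃ j < p, a = ‖fourierCoeff m p j‖}

/-- `B`: the magnitude of the strongest present frequency
(it is `0` if no frequency is present, that is, if `m` is identically zero). -/
def maxMagnitude (m : ℕ → ℝ) (p : ℕ) : ℝ := sSup (presentMagnitudes m p)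

/-- `b`: the magnitude of the weakest present frequency, with the usual convention
`inf ∅ = +∞` if no frequency is present, that is, if `m` is identically zero. -/
def minMagnitude (m : ℕ → ℝ) (p : ℕ) : EReal :=
  sInf ((fun a : ℝ => (a : EReal)) '' presentMagnitudes m p)

/-! ### The quantities computed by the algorithm

Arms are numbered `0, …, K - 1`; arm `k` is pulled at the `n` consecutive epochs
`n k + 1, …, n (k + 1)`. In what follows `y t` is the reward of arm `k` at epoch `t`. -/

/-- The periodogram `|(1/n) ∑_{s = n k + 1}^{n (k + 1)} y_s exp (-2 π i v s)|`. -/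
def periodogram (n k : ℕ) (y : ℕ → ℝ) (v : ℝ) : ℝ :=
  ‖(1 / (n : ℂ)) * ∑ s ∈ Finset.Icc (n * k + 1) (n * (k + 1)),
    (y s : ℂ) * Complex.exp (-(2 * Real.pi * Complex.I * v * s))‖

/-- The candidate frequencies `j₁ / j₂` with `1 ≤ j₁ < j₂ < n / (2 g)`. -/
def candidateFrequencies (n g : ℕ) : Set ℚ :=
  {q | ∃ j₁ j₂ : ℕ, 1 ≤ j₁ ∧ j₁ < j₂ ∧ (j₂ : ℝ) < (n : ℝ) / (2 * g) ∧ q = (j₁ : ℚ) / (j₂ : ℚ)}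

/-- `A_j = sup {|sin (π ν)| / (π ν) : ν ∈ [j, j + 1]}` (used for `j ≥ 1` only). -/
def lobeSup (j : ℕ) : ℝ :=
  sSup ((fun ν : ℝ => |Real.sin (Real.pi * ν)| / (Real.pi * ν)) '' Set.Icc (j : ℝ) (j + 1))

/-- `U₁ = ∑_{j=0}^{⌊(n - 2g - 1) / (4g)⌋} A_{(2j+1)g}`. The natural-number operations are exact
here since `n ≥ 2g + 1` whenever some arm has a period `< n / (2g)`. -/
def leakageOne (n g : ℕ) : ℝ :=
  ∑ j ∈ Finset.range ((n - 2 * g - 1) / (4 * g) + 1), lobeSup ((2 * j + 1) * g)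

/-- `U₂ = ∑_{j=1}^{⌊(n - 1) / (4g)⌋} A_{2jg-1}`. -/
def leakageTwo (n g : ℕ) : ℝ :=
  ∑ j ∈ Finset.Icc 1 ((n - 1) / (4 * g)), lobeSup (2 * j * g - 1)

/-- `ε̄ = (2 σ H / (1 - π / 24)) √(log n / n)`. -/
def noiseLevel (n : ℕ) (σ H : ℝ) : ℝ :=
  2 * σ * H / (1 - Real.pi / 24) * Real.sqrt (Real.log n / n)

/-- The threshold `ε̄ + (π U₁ / (1 - π U₂)) (ε̄ + sup_{v ∈ [0, 1/2]} Y(v))` for a periodogram `Y`. -/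
def threshold (n g : ℕ) (σ H : ℝ) (Y : ℝ → ℝ) : ℝ :=
  noiseLevel n σ H + Real.pi * leakageOne n g / (1 - Real.pi * leakageTwo n g) *
    (noiseLevel n σ H + sSup (Y '' Set.Icc (0 : ℝ) (1 / 2)))

/-- The initial frequency domain `{v : g / n ≤ v ≤ 1 / 2, Y(v) > threshold}`. -/
def initialDomain (n g : ℕ) (σ H : ℝ) (Y : ℝ → ℝ) : Set ℝ :=
  {v | (g : ℝ) / n ≤ v ∧ v ≤ 1 / 2 ∧ threshold n g σ H Y < Y v}

/-! ### The search loop -/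

/-- The state of the search: the current frequency domain and the frequencies found so far. -/
structure SearchState where
  domain : Set ℝ
  found : List ℚ

/-- One pass through the loop: some global maximiser `w` of the periodogram `Y` over the
current domain is chosen, some candidate frequency `q` closest to `w` is recorded, and the open
interval of radius `g / n` around `q` is removed. The relation allows every way of breaking ties. -/
def SearchStep (n g : ℕ) (Y : ℝ → ℝ) (s s' : SearchState) : Prop :=
  ∃ w ∈ s.domain, IsMaxOn Y s.domain w ∧
    ∃ q ∈ candidateFrequencies n g,
      IsMinOn (fun r : ℚ => |(r : ℝ) - w|) (candidateFrequencies n g) q ∧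
      s'.domain = s.domain \ Set.Ioo ((q : ℝ) - (g : ℝ) / n) ((q : ℝ) + (g : ℝ) / n) ∧
      s'.found = q :: s.found

/-- The least common multiple of the reciprocals of the frequencies in a list: the least positive
integer that is an integer multiple of `q⁻¹` for all `q` in the list (`1` for the empty list). -/
def lcmReciprocals (l : List ℚ) : ℕ :=
  sInf {m : ℕ | 0 < m ∧ ∀ q ∈ l, ∃ c : ℕ, (m : ℚ) = c * q⁻¹}

/-- From state `s` the search loop terminates and returns `m`, however ties are broken:
if the domain is empty it halts with the least common multiple, otherwise a pass through the
loop is possible and every possible pass leads to a state with this property. -/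
inductive AlwaysReturns (n g : ℕ) (Y : ℝ → ℝ) : SearchState → ℕ → Prop
  | halt (s : SearchState) (h : s.domain = ∅) : AlwaysReturns n g Y s (lcmReciprocals s.found)
  | step (s : SearchState) (m : ℕ) (hne : s.domain.Nonempty)
      (hex : ∃ s', SearchStep n g Y s s')
      (hall : ∀ s', SearchStep n g Y s s' → AlwaysReturns n g Y s' m) : AlwaysReturns n g Y s m

/-- On the rewards `y` of arm `k` the algorithm terminates and estimates the period of this arm
as `m`, however ties are broken. -/
def EstimatesPeriod (n g : ℕ) (σ H : ℝ) (k : ℕ) (y : ℕ → ℝ) (m : ℕ) : Prop :=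
  AlwaysReturns n g (periodogram n k y)
    ⟨initialDomain n g σ H (periodogram n k y), []⟩ m

/-! ### The bandit model and the assumptions -/

/-- The reward `Y_{k,t} = μ_{k,t} + ε_t`. -/
def reward {Ω : Type*} {K : ℕ} (μ : Fin K → ℕ → ℝ) (ε : ℕ → Ω → ℝ) (ω : Ω) (k : Fin K) (t : ℕ) :
    ℝ :=
  μ k t + ε t ω

/-- The noise variables `ε_1, …, ε_T` are independent and sub-Gaussian with parameter `σ`:
`E[exp (x ε_t)] ≤ exp (σ² x² / 2)` for all real `x`. That they are centred and satisfy
`P(|ε_t| > x) ≤ 2 exp (-x² / (2 σ²))` follows from this. -/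
structure SubGaussianNoise {Ω : Type*} [MeasurableSpace Ω] (P : Measure Ω) (T : ℕ) (σ : ℝ≥0)
    (ε : ℕ → Ω → ℝ) : Prop where
  measurable : ∀ t ∈ Finset.Icc 1 T, Measurable (ε t)
  indep : iIndepFun (fun t : Finset.Icc 1 T => ε t) P
  subGaussian : ∀ t ∈ Finset.Icc 1 T, HasSubgaussianMGF (ε t) (σ ^ 2) P

/-- The condition on the horizon, the neighbourhood parameter `g` and the periods `p k`. -/
structure PeriodCondition (K T n g : ℕ) (p : Fin K → ℕ) : Prop where
  horizon : 4 * K < T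
  two_le : 2 ≤ g
  sqrt_le : Real.sqrt n ≤ g
  period_lt : ∀ k, (p k : ℝ) < (n : ℝ) / (2 * g)

/-- The condition that the weakest present frequency of an arm is not too weak in comparison with
the noise level and with the strongest present frequency. -/
def MagnitudeCondition (n g : ℕ) (σ H : ℝ) (m : ℕ → ℝ) (p : ℕ) : Prop :=
  (((2 * Real.pi * leakageOne n g / (1 - Real.pi * leakageTwo n g) + 2) * noiseLevel n σ H +
      max (8 * Real.pi / 3 * leakageTwo n g)
        (Real.pi * leakageOne n g / (1 - Real.pi * leakageTwo n g) *
            max (Real.pi * leakageOne n g) (Real.pi * leakageTwo n g + 1) +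
          Real.pi * leakageTwo n g) * maxMagnitude m p : ℝ) : EReal) ≤ minMagnitude m p

/-- The event that, for every arm, the algorithm estimates the period correctly. -/
def correctEvent {Ω : Type*} {K : ℕ} (n g : ℕ) (σ H : ℝ) (μ : Fin K → ℕ → ℝ) (ε : ℕ → Ω → ℝ)
    (p : Fin K → ℕ) : Set Ω :=
  {ω | ∀ k : Fin K, EstimatesPeriod n g σ H k (reward μ ε ω k) (p k)}

end

end PeriodicBandit

/-! The periodogram of a periodic signal is a superposition of Dirichlet kernels centred at the
frequencies `j / p` with a nonzero Fourier coefficient. Away from these frequencies the leakage of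
the kernels is bounded by `U₁` and `U₂`, so when the noise is small the threshold keeps every
present frequency and otherwise only points within `g / n` of one. A maximiser over what remains of
the domain lies within `2 / n` of a present frequency, because the main kernel has decayed too much
at distance `2 / n`. Distinct fractions whose denominators are below `n / (2 g)` are at least
`4 / n` apart, as `n ≤ g ^ 2`, so rounding to the closest candidate recovers the present frequency
exactly. The search thus finds all the present frequencies in `(0, 1 / 2]`, and by Fourier
inversion the least common multiple of their reciprocals is the minimal period.

The noise is controlled by a sub-Gaussian tail bound on a grid of `50 n` frequencies. A polynomial
of degree less than `n` is dominated on the unit circle by its values at the `50 n`-th roots of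
unity, up to the factor `√(50 / 49)`, so the bound on the grid gives one at all frequencies. The
union bound over the grid costs only the last of the three error terms. -/

namespace PeriodicBandit

noncomputable section

open Finset (range Icc Ico)
open scoped Real

/-! ### The Dirichlet kernel -/

section Dirichlet

variable {n : ℕ}

/-- The modulus of the normalised Dirichlet kernel `(1/n) ∑_{i < n} exp (2 π i x i)`: the size of
the periodogram of a pure tone at distance `x` from its frequency. -/
def dirichlet (n : ℕ) (x : ℝ) : ℝ :=
  ‖(1 / (n : ℂ)) * ∑ i ∈ range n, Complex.exp (2 * π * Complex.I * x * i)‖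

theorem norm_exp_two_pi_mul (x : ℝ) (s : ℕ) :
    ‖Complex.exp (2 * π * Complex.I * x * s)‖ = 1 := by
  rw [show (2 * π * Complex.I * x * s : ℂ) = ((2 * π * x * s : ℝ) : ℂ) * Complex.I by
    push_cast; ring]
  exact Complex.norm_exp_ofReal_mul_I _

theorem dirichlet_nonneg (n : ℕ) (x : ℝ) : 0 ≤ dirichlet n x := norm_nonneg _

theorem dirichlet_zero (hn : n ≠ 0) : dirichlet n 0 = 1 := by
  simp [dirichlet, hn]

theorem dirichlet_le_one (n : ℕ) (x : ℝ) : dirichlet n x ≤ 1 := by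
  calc dirichlet n x
      ≤ ‖(1 / (n : ℂ))‖ * ∑ i ∈ range n, ‖Complex.exp (2 * π * Complex.I * x * i)‖ :=
        (norm_mul_le _ _).trans (by gcongr; exact norm_sum_le _ _)
    _ = (n : ℝ)⁻¹ * n := by simp [norm_exp_two_pi_mul]
    _ ≤ 1 := inv_mul_le_one

theorem dirichlet_add_one (n : ℕ) (x : ℝ) : dirichlet n (x + 1) = dirichlet n x := by
  unfold dirichlet
  congr 2
  refine Finset.sum_congr rfl fun i _ ↦ ?_
  rw [Complex.exp_eq_exp_iff_exists_int]
  exact ⟨i, by push_cast; ring⟩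

theorem dirichlet_neg (n : ℕ) (x : ℝ) : dirichlet n (-x) = dirichlet n x := by
  unfold dirichlet
  rw [← Complex.norm_conj]
  simp [← Complex.exp_conj, map_ofNat]

theorem dirichlet_abs (n : ℕ) (x : ℝ) : dirichlet n |x| = dirichlet n x := by
  rcases abs_choice x with h | h <;> rw [h]
  exact dirichlet_neg n x

theorem norm_exp_two_pi_sub_one (x : ℝ) :
    ‖Complex.exp (2 * π * Complex.I * x) - 1‖ = 2 * |Real.sin (π * x)| := by
  rw [show (2 * π * Complex.I * x : ℂ) = Complex.I * ((2 * π * x : ℝ) : ℂ) by push_cast; ring,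
    Complex.norm_exp_I_mul_ofReal_sub_one, norm_mul, Real.norm_eq_abs, Real.norm_eq_abs, abs_two]
  congr 3
  ring

theorem dirichlet_mul_sin (n : ℕ) (x : ℝ) :
    dirichlet n x * (n * |Real.sin (π * x)|) = |Real.sin (π * (n * x))| := by
  rcases eq_or_ne n 0 with rfl | hn
  · simp
  set z := Complex.exp (2 * π * Complex.I * x) with hz
  have hpow (i : ℕ) : Complex.exp (2 * π * Complex.I * x * i) = z ^ i := by
    rw [hz, ← Complex.exp_nat_mul, mul_comm]
  have hkernel : dirichlet n x * n = ‖∑ i ∈ range n, z ^ i‖ := by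
    simp only [dirichlet, hpow, norm_mul]
    simp [mul_comm, hn]
  have hgeom : ‖∑ i ∈ range n, z ^ i‖ * ‖z - 1‖ = ‖z ^ n - 1‖ := by
    rw [← norm_mul, geom_sum_mul]
  rw [← hpow, show (2 * π * Complex.I * x * n : ℂ) = 2 * π * Complex.I * ((n * x : ℝ) : ℂ) by
    push_cast; ring, norm_exp_two_pi_sub_one, norm_exp_two_pi_sub_one, ← hkernel] at hgeom
  linarith

theorem two_mul_le_sin_pi_mul {d : ℝ} (h0 : 0 ≤ d) (h1 : d ≤ 1 / 2) :
    2 * d ≤ Real.sin (π * d) :=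
  calc 2 * d = 2 / π * (π * d) := by field_simp
    _ ≤ Real.sin (π * d) :=
      Real.mul_le_sin (by positivity) (by nlinarith [Real.pi_pos])

-- Concavity of the sine on `[0, π / 4]` gives the slope `2√2`, which is rounded down to `8 / 3`.
theorem eight_thirds_mul_le_sin_pi_mul {d : ℝ} (h0 : 0 ≤ d) (h1 : d ≤ 1 / 4) :
    8 / 3 * d ≤ Real.sin (π * d) := by
  have hconcave := strictConcaveOn_sin_Icc.concaveOn.2
    (⟨le_rfl, Real.pi_pos.le⟩ : (0 : ℝ) ∈ Set.Icc 0 π)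
    (⟨by positivity, by linarith [Real.pi_pos]⟩ : π / 4 ∈ Set.Icc 0 π)
    (show (0 : ℝ) ≤ 1 - 4 * d by linarith) (show 0 ≤ 4 * d by linarith) (by ring)
  simp only [smul_eq_mul, mul_zero, zero_add, Real.sin_zero, Real.sin_pi_div_four] at hconcave
  rw [show 4 * d * (π / 4) = π * d by ring] at hconcave
  have hsqrt : (4 / 3 : ℝ) ≤ √2 := Real.le_sqrt_of_sq_le (by norm_num)
  nlinarith

theorem dirichlet_le_of_mul_le_sin (hn : 0 < n) {d a : ℝ} (h0 : 0 < d) (ha : 0 < a)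
    (h : a * d ≤ Real.sin (π * d)) :
    dirichlet n d ≤ |Real.sin (π * (n * d))| / (a * (n * d)) := by
  have : (0 : ℝ) < n := by exact_mod_cast hn
  rw [le_div_iff₀ (by positivity), ← dirichlet_mul_sin]
  refine mul_le_mul_of_nonneg_left ?_ (dirichlet_nonneg _ _)
  have := le_abs_self (Real.sin (π * d))
  nlinarith

theorem dirichlet_le_inv (hn : 0 < n) {d : ℝ} (h0 : 0 < d) (h1 : d ≤ 1 / 2) :
    dirichlet n d ≤ 1 / (2 * (n * d)) := by
  refine (dirichlet_le_of_mul_le_sin hn h0 two_pos (two_mul_le_sin_pi_mul h0.le h1)).trans ?_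
  gcongr
  exact Real.abs_sin_le_one _

theorem dirichlet_le_three_eighths (hn : 0 < n) {d : ℝ} (h0 : 0 < d) (h1 : d ≤ 1 / 4) :
    dirichlet n d ≤ 3 / (8 * (n * d)) := by
  refine (dirichlet_le_of_mul_le_sin hn h0 (by norm_num)
    (eight_thirds_mul_le_sin_pi_mul h0.le h1)).trans ?_
  rw [show (3 : ℝ) / (8 * (n * d)) = 1 / (8 / 3 * (n * d)) by field_simp]
  gcongr
  exact Real.abs_sin_le_one _

end Dirichlet

/-! ### Suprema over the side lobes -/

section Lobes

variable {j : ℕ}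

theorem lobe_le_inv (hj : 1 ≤ j) {ν : ℝ} (hν : (j : ℝ) ≤ ν) :
    |Real.sin (π * ν)| / (π * ν) ≤ 1 / (π * j) := by
  have : (1 : ℝ) ≤ j := by exact_mod_cast hj
  gcongr
  exact Real.abs_sin_le_one _

theorem pi_mul_lobeSup_le (hj : 1 ≤ j) : π * lobeSup j ≤ 1 / j := by
  have hle : lobeSup j ≤ 1 / (π * j) := by
    refine csSup_le ⟨_, j, ⟨le_rfl, by linarith⟩, rfl⟩ ?_
    rintro _ ⟨ν, hν, rfl⟩
    exact lobe_le_inv hj hν.1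
  calc π * lobeSup j ≤ π * (1 / (π * j)) := by gcongr
    _ = 1 / j := by field_simp

theorem abs_sin_pi_mul_sub_nat (ν : ℝ) (m : ℕ) :
    |Real.sin (π * (ν - m))| = |Real.sin (π * ν)| := by
  rw [mul_sub, mul_comm π (m : ℝ), Real.sin_sub_nat_mul_pi, abs_mul, abs_pow]
  simp

-- The numerator has period `1`, so moving `ν` back to `[j, j + 1]` only increases the quotient.
theorem le_lobeSup (hj : 1 ≤ j) {ν : ℝ} (hν : (j : ℝ) ≤ ν) :
    |Real.sin (π * ν)| / (π * ν) ≤ lobeSup j := by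
  have : (1 : ℝ) ≤ j := by exact_mod_cast hj
  set m := ⌊ν - j⌋₊
  have hm : (m : ℝ) ≤ ν - j := Nat.floor_le (by linarith)
  have hm' : ν - j < m + 1 := Nat.lt_floor_add_one _
  have hbdd : BddAbove ((fun ν : ℝ ↦ |Real.sin (π * ν)| / (π * ν)) '' Set.Icc (j : ℝ) (j + 1)) := by
    refine ⟨1 / (π * j), ?_⟩
    rintro _ ⟨ν, hν, rfl⟩
    exact lobe_le_inv hj hν.1
  have hpos : 0 < ν - m := by linarith
  calc |Real.sin (π * ν)| / (π * ν) = |Real.sin (π * (ν - m))| / (π * ν) := by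
        rw [abs_sin_pi_mul_sub_nat]
    _ ≤ |Real.sin (π * (ν - m))| / (π * (ν - m)) := by
        gcongr
        exact sub_le_self _ m.cast_nonneg
    _ ≤ lobeSup j := le_csSup hbdd ⟨ν - m, ⟨by linarith, by linarith⟩, rfl⟩

theorem le_pi_mul_lobeSup (hj : 1 ≤ j) : 1 / (j + 1 / 2) ≤ π * lobeSup j := by
  have hsin : |Real.sin (π * ((j : ℝ) + 1 / 2))| = 1 := by
    rw [show π * ((j : ℝ) + 1 / 2) = π / 2 + j * π by ring, Real.sin_add_nat_mul_pi]
    simp [abs_pow]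
  calc 1 / ((j : ℝ) + 1 / 2)
      = π * (|Real.sin (π * (j + 1 / 2))| / (π * (j + 1 / 2))) := by rw [hsin]; field_simp
    _ ≤ π * lobeSup j := by
        gcongr
        exact le_lobeSup hj (by linarith)

theorem lobeSup_nonneg (hj : 1 ≤ j) : 0 ≤ lobeSup j :=
  nonneg_of_mul_nonneg_right (le_trans (by positivity) (le_pi_mul_lobeSup hj)) Real.pi_pos

theorem dirichlet_le_lobeSup {n : ℕ} (hj : 1 ≤ j) {d : ℝ} (h1 : d ≤ 1 / 2)
    (hd : (j : ℝ) ≤ n * d) : dirichlet n d ≤ π / 2 * lobeSup j := by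
  have hnd : 0 < (n : ℝ) * d := lt_of_lt_of_le (by exact_mod_cast hj) hd
  have h0 : 0 < d := pos_of_mul_pos_right hnd n.cast_nonneg
  have hn : 0 < n := by exact_mod_cast pos_of_mul_pos_left hnd h0.le
  calc dirichlet n d ≤ |Real.sin (π * (n * d))| / (2 * (n * d)) :=
        dirichlet_le_of_mul_le_sin hn h0 two_pos (two_mul_le_sin_pi_mul h0.le h1)
    _ = π / 2 * (|Real.sin (π * (n * d))| / (π * (n * d))) := by field_simp
    _ ≤ π / 2 * lobeSup j := by
        gcongr
        exact le_lobeSup hj hd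

end Lobes

/-! ### Sums of the Dirichlet kernel over the frequencies `i / p` -/

section Sums

variable {n g p i : ℕ} {δ x : ℝ}

theorem sum_range_add_of_periodic {M : Type*} [AddCancelCommMonoid M] {f : ℕ → M}
    (hf : Function.Periodic f p) (c : ℕ) :
    ∑ i ∈ range p, f (c + i) = ∑ i ∈ range p, f i := by
  induction c with
  | zero => simp
  | succ c ih =>
    have h : ∑ i ∈ range p, f (c + (i + 1)) + f (c + 0) = ∑ i ∈ range p, f (c + i) + f (c + p) := by
      rw [← Finset.sum_range_succ' (fun i ↦ f (c + i)), Finset.sum_range_succ]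
    rw [hf c, add_zero] at h
    simpa only [add_assoc, add_comm 1] using (add_right_cancel h).trans ih

theorem sum_erase_of_periodic {M : Type*} [AddCancelCommMonoid M] {f : ℕ → M} {c : ℕ}
    (hf : Function.Periodic f p) (hc : c < p) :
    ∑ j ∈ (range p).erase c, f j = ∑ i ∈ Ico 1 p, f (c + i) := by
  have h := sum_range_add_of_periodic hf c
  rw [← Finset.add_sum_erase _ f (Finset.mem_range.mpr hc), Finset.range_eq_Ico,
    Finset.sum_eq_sum_Ico_succ_bot (by omega), add_zero, zero_add, ← Finset.range_eq_Ico] at h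
  exact (add_left_cancel h).symm

theorem dirichlet_sub_div_sub (n : ℕ) (hp : 0 < p) (hi : i ≤ p) (δ : ℝ) :
    dirichlet n (((p - i : ℕ) : ℝ) / p - δ) = dirichlet n (i / p + δ) := by
  rw [← dirichlet_neg, ← dirichlet_add_one]
  congr 1
  push_cast [hi]
  field_simp
  ring

-- The frequencies in the second half are counted backwards from `1`, by the periodicity of the
-- kernel; then all its arguments are at most `1 / 2` in modulus, where it decays.
theorem sum_Ico_dirichlet_fold (n : ℕ) (hp : 0 < p) (δ : ℝ) :
    ∑ i ∈ Ico 1 p, dirichlet n ((i : ℝ) / p - δ) =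
      ∑ i ∈ Ico 1 (p / 2 + 1), dirichlet n ((i : ℝ) / p - δ) +
        ∑ i ∈ Ico 1 (p - p / 2), dirichlet n ((i : ℝ) / p + δ) := by
  have hreflect := Finset.sum_Ico_reflect (fun i : ℕ ↦ dirichlet n ((i : ℝ) / p - δ)) 1
    (show p - p / 2 ≤ p + 1 by omega)
  rw [show p + 1 - (p - p / 2) = p / 2 + 1 by omega, Nat.add_sub_cancel] at hreflect
  rw [← Finset.sum_Ico_consecutive _ (show 1 ≤ p / 2 + 1 by omega)
    (show p / 2 + 1 ≤ p by omega), ← hreflect]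
  congr 1
  refine Finset.sum_congr rfl fun i hi ↦ ?_
  rw [Finset.mem_Ico] at hi
  exact dirichlet_sub_div_sub n hp (by omega) δ

theorem sum_range_dirichlet_fold (n : ℕ) (hp : 0 < p) (δ : ℝ) :
    ∑ i ∈ range p, dirichlet n ((i : ℝ) / p - δ) =
      ∑ i ∈ Ico 1 (p / 2 + 1), dirichlet n ((i : ℝ) / p - δ) +
        ∑ i ∈ range (p - p / 2), dirichlet n ((i : ℝ) / p + δ) := by
  rw [Finset.range_eq_Ico, Finset.range_eq_Ico, Finset.sum_eq_sum_Ico_succ_bot hp,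
    Finset.sum_eq_sum_Ico_succ_bot (by omega : 0 < p - p / 2), zero_add,
    sum_Ico_dirichlet_fold n hp, Nat.cast_zero, zero_div, zero_sub, zero_add, dirichlet_neg]
  ring

theorem sum_Ico_dirichlet_abs (n : ℕ) (hp : 0 < p) (δ : ℝ) :
    ∑ i ∈ Ico 1 p, dirichlet n ((i : ℝ) / p - |δ|) =
      ∑ i ∈ Ico 1 p, dirichlet n ((i : ℝ) / p - δ) := by
  rcases abs_choice δ with h | h <;> rw [h]
  have hreflect := Finset.sum_Ico_reflect (fun i : ℕ ↦ dirichlet n ((i : ℝ) / p - δ)) 1 p.le_succ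
  rw [Nat.add_sub_cancel_left, Nat.add_sub_cancel] at hreflect
  rw [← hreflect]
  refine Finset.sum_congr rfl fun i hi ↦ ?_
  rw [dirichlet_sub_div_sub n hp (Finset.mem_Ico.mp hi).2.le, sub_neg_eq_add]

theorem sum_range_dirichlet_abs (n : ℕ) (hp : 0 < p) (δ : ℝ) :
    ∑ i ∈ range p, dirichlet n ((i : ℝ) / p - |δ|) =
      ∑ i ∈ range p, dirichlet n ((i : ℝ) / p - δ) := by
  simp only [Finset.range_eq_Ico, Finset.sum_eq_sum_Ico_succ_bot hp, zero_add,
    sum_Ico_dirichlet_abs n hp, Nat.cast_zero, zero_div, zero_sub, dirichlet_neg, dirichlet_abs]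

theorem two_mul_mul_le_mul_div (hp : 0 < p) (hn : 2 * g * p ≤ n) {a : ℝ} (ha : 0 ≤ a) :
    2 * a * g ≤ n * (a / p) := by
  have : (0 : ℝ) < p := by exact_mod_cast hp
  have hn' : (2 * g * p : ℝ) ≤ n := by exact_mod_cast hn
  rw [← mul_div_assoc, le_div_iff₀ this]
  nlinarith

theorem dirichlet_div_sub_le (hg : 0 < g) (hn : 2 * g * p ≤ n) (hi : 1 ≤ i) (hip : 2 * i ≤ p)
    (hx : 0 ≤ x) (hxg : n * x ≤ g) :
    dirichlet n ((i : ℝ) / p - x) ≤ 1 / (2 * (2 * i * g - n * x)) := by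
  have hp : 0 < p := by omega
  have hn0 : 0 < n := lt_of_lt_of_le (by positivity) hn
  have : (0 : ℝ) < p := by exact_mod_cast hp
  have : (0 : ℝ) < n := by exact_mod_cast hn0
  have : (0 : ℝ) < g := by exact_mod_cast hg
  have : (1 : ℝ) ≤ i := by exact_mod_cast hi
  have hip' : (2 * i : ℝ) ≤ p := by exact_mod_cast hip
  have hdist : 2 * i * g - n * x ≤ n * ((i : ℝ) / p - x) := by
    linarith [two_mul_mul_le_mul_div hp hn i.cast_nonneg]
  have hpos : 0 < 2 * i * g - n * x := by nlinarith
  have hle : (i : ℝ) / p ≤ 1 / 2 := by rw [div_le_iff₀ (by assumption)]; linarith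
  refine (dirichlet_le_inv hn0 ?_ (by linarith)).trans (by gcongr)
  exact pos_of_mul_pos_right (hpos.trans_le hdist) (by positivity)

theorem dirichlet_div_add_le (hg : 0 < g) (hn : 2 * g * p ≤ n) (hi : 1 ≤ i) (hip : 2 * i + 1 ≤ p)
    (hx : 0 ≤ x) (hxg : n * x ≤ g) :
    dirichlet n ((i : ℝ) / p + x) ≤ 1 / (2 * (2 * i * g + n * x)) := by
  have hp : 0 < p := by omega
  have hn0 : 0 < n := lt_of_lt_of_le (by positivity) hn
  have : (0 : ℝ) < p := by exact_mod_cast hp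
  have : (0 : ℝ) < n := by exact_mod_cast hn0
  have : (0 : ℝ) < g := by exact_mod_cast hg
  have : (1 : ℝ) ≤ i := by exact_mod_cast hi
  have hip' : (2 * i + 1 : ℝ) ≤ p := by exact_mod_cast hip
  have hdist : 2 * i * g + n * x ≤ n * ((i : ℝ) / p + x) := by
    linarith [two_mul_mul_le_mul_div hp hn i.cast_nonneg]
  have hxp : 2 * x ≤ 1 / p := by
    have := two_mul_mul_le_mul_div hp hn zero_le_one
    have : (n : ℝ) * (2 * x) ≤ n * (1 / p) := by linarith
    exact le_of_mul_le_mul_left this (by assumption)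
  have hle : (i : ℝ) / p + x ≤ 1 / 2 := by
    calc (i : ℝ) / p + x ≤ i / p + 1 / p / 2 := by linarith
      _ = (2 * i + 1) / p / 2 := by ring
      _ ≤ 1 / 2 := by
        gcongr
        exact (div_le_one₀ (by assumption)).mpr hip'
  exact (dirichlet_le_inv hn0 (by positivity) hle).trans (by gcongr)

theorem sum_Ico_dirichlet_le (hg : 0 < g) (hp : 0 < p) (hn : 2 * g * p ≤ n) (hδ : n * |δ| ≤ g) :
    ∑ i ∈ Ico 1 p, dirichlet n ((i : ℝ) / p - δ) ≤
      ∑ i ∈ Icc 1 (p / 2),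
        (1 / (2 * (2 * i * g - n * |δ|)) + 1 / (2 * (2 * i * g + n * |δ|))) := by
  rw [← sum_Ico_dirichlet_abs n hp, sum_Ico_dirichlet_fold n hp, Finset.sum_add_distrib,
    ← Finset.Ico_add_one_right_eq_Icc]
  refine add_le_add (Finset.sum_le_sum fun i hi ↦ ?_) ?_
  · rw [Finset.mem_Ico] at hi
    exact dirichlet_div_sub_le hg hn hi.1 (by omega) (abs_nonneg δ) hδ
  · calc ∑ i ∈ Ico 1 (p - p / 2), dirichlet n ((i : ℝ) / p + |δ|)
        ≤ ∑ i ∈ Ico 1 (p - p / 2), 1 / (2 * (2 * i * g + n * |δ|)) := by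
          refine Finset.sum_le_sum fun i hi ↦ ?_
          rw [Finset.mem_Ico] at hi
          exact dirichlet_div_add_le hg hn hi.1 (by omega) (abs_nonneg δ) hδ
      _ ≤ ∑ i ∈ Ico 1 (p / 2 + 1), 1 / (2 * (2 * i * g + n * |δ|)) :=
          Finset.sum_le_sum_of_subset_of_nonneg (Finset.Ico_subset_Ico_right (by omega))
            fun i _ _ ↦ by positivity

theorem dirichlet_div_sub_le_lobeSup (hg : 0 < g) (hn : 2 * g * p ≤ n) (hip : 2 * (i + 1) ≤ p)
    (hx : 0 ≤ x) (hx' : p * x ≤ 1 / 2) :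
    dirichlet n (((i + 1 : ℕ) : ℝ) / p - x) ≤ π / 2 * lobeSup ((2 * i + 1) * g) := by
  have hp : 0 < p := by omega
  have : (0 : ℝ) < p := by exact_mod_cast hp
  have hip' : (2 * (i + 1) : ℝ) ≤ p := by exact_mod_cast hip
  have hdist : ((i : ℝ) + 1 / 2) / p ≤ (i + 1) / p - x := by
    have : x ≤ 1 / 2 / p := by rw [le_div_iff₀ (by assumption)]; linarith
    calc ((i : ℝ) + 1 / 2) / p = (i + 1) / p - 1 / 2 / p := by ring
      _ ≤ (i + 1) / p - x := by gcongr
  refine dirichlet_le_lobeSup (Nat.mul_pos (by omega) hg) ?_ ?_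
  · have : ((i + 1 : ℕ) : ℝ) / p ≤ 1 / 2 := by
      rw [div_le_iff₀ (by assumption)]
      push_cast
      linarith
    linarith
  · push_cast
    calc (2 * (i : ℝ) + 1) * g = 2 * (i + 1 / 2) * g := by ring
      _ ≤ n * ((i + 1 / 2) / p) := two_mul_mul_le_mul_div hp hn (by positivity)
      _ ≤ n * ((i + 1) / p - x) := by gcongr

theorem dirichlet_div_add_le_lobeSup (hg : 0 < g) (hn : 2 * g * p ≤ n) (hip : 2 * i + 1 ≤ p)
    (hx : g ≤ n * x) (hx' : p * x ≤ 1 / 2) :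
    dirichlet n ((i : ℝ) / p + x) ≤ π / 2 * lobeSup ((2 * i + 1) * g) := by
  have hp : 0 < p := by omega
  have : (0 : ℝ) < p := by exact_mod_cast hp
  have hip' : (2 * i + 1 : ℝ) ≤ p := by exact_mod_cast hip
  refine dirichlet_le_lobeSup (Nat.mul_pos (by omega) hg) ?_ ?_
  · rw [div_add' _ _ _ (by positivity), div_le_iff₀ (by assumption)]
    linarith
  · push_cast
    linarith [two_mul_mul_le_mul_div hp hn i.cast_nonneg]

theorem sum_range_le_leakageOne (hg : 0 < g) (hn : 2 * g * p < n) {q : ℕ} (hq : 2 * q ≤ p + 1)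
    {f : ℕ → ℝ} (hf : ∀ i < q, f i ≤ π / 2 * lobeSup ((2 * i + 1) * g)) :
    ∑ i ∈ range q, f i ≤ π / 2 * leakageOne n g := by
  have hq' : q ≤ (n - 2 * g - 1) / (4 * g) + 1 := by
    rcases q with _ | q
    · exact Nat.zero_le _
    refine Nat.succ_le_succ ((Nat.le_div_iff_mul_le (by omega)).mpr ?_)
    have : 2 * g * (2 * q + 1) ≤ 2 * g * p := by gcongr; omega
    have : q * (4 * g) + 2 * g = 2 * g * (2 * q + 1) := by ring
    omega
  rw [leakageOne, Finset.mul_sum]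
  refine (Finset.sum_le_sum fun i hi ↦ hf i (Finset.mem_range.mp hi)).trans ?_
  refine Finset.sum_le_sum_of_subset_of_nonneg (Finset.range_mono hq') fun i _ _ ↦ ?_
  exact mul_nonneg (by positivity) (lobeSup_nonneg (Nat.mul_pos (by omega) hg))

theorem sum_range_dirichlet_le (hg : 0 < g) (hp : 0 < p) (hn : 2 * g * p < n)
    (hδ : g ≤ n * |δ|) (hδ' : p * |δ| ≤ 1 / 2) :
    ∑ i ∈ range p, dirichlet n ((i : ℝ) / p - δ) ≤ π * leakageOne n g := by
  have hleft : ∑ i ∈ Ico 1 (p / 2 + 1), dirichlet n ((i : ℝ) / p - |δ|) ≤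
      π / 2 * leakageOne n g := by
    rw [Finset.sum_Ico_eq_sum_range, Nat.add_sub_cancel]
    refine sum_range_le_leakageOne hg hn (by omega) fun i hi ↦ ?_
    rw [add_comm 1 i]
    exact dirichlet_div_sub_le_lobeSup hg hn.le (by omega) (abs_nonneg δ) hδ'
  have hright : ∑ i ∈ range (p - p / 2), dirichlet n ((i : ℝ) / p + |δ|) ≤
      π / 2 * leakageOne n g :=
    sum_range_le_leakageOne hg hn (by omega) fun i hi ↦
      dirichlet_div_add_le_lobeSup hg hn.le (by omega) hδ hδ'
  rw [← sum_range_dirichlet_abs n hp, sum_range_dirichlet_fold n hp]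
  linarith

end Sums

/-! ### Numerical bounds for the leakages -/

section Leakage

variable {n g p i : ℕ} {ν δ : ℝ}

theorem sum_inv_cubic_le (m : ℕ) :
    ∑ i ∈ Icc 1 m, 1 / (2 * (i : ℝ) * (4 * (i : ℝ) ^ 2 - 1)) ≤ 5 / 24 := by
  rcases Nat.eq_zero_or_pos m with rfl | hm
  · norm_num
  suffices h : ∑ i ∈ Icc 1 m, 1 / (2 * (i : ℝ) * (4 * (i : ℝ) ^ 2 - 1)) ≤
      5 / 24 - 1 / (8 * (2 * (m : ℝ) + 1)) from
    h.trans (sub_le_self _ (by positivity))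
  induction m, hm using Nat.le_induction with
  | base => norm_num
  | succ m hm ih =>
    have : (1 : ℝ) ≤ m := by exact_mod_cast hm
    have hterm : 1 / (2 * ((m : ℝ) + 1) * (4 * ((m : ℝ) + 1) ^ 2 - 1)) ≤
        1 / (8 * (2 * m + 1)) - 1 / (8 * (2 * (m + 1) + 1)) := by
      rw [show (4 * ((m : ℝ) + 1) ^ 2 - 1) = (2 * m + 1) * (2 * m + 3) by ring,
        div_sub_div _ _ (by positivity) (by positivity), div_le_div_iff₀ (by positivity)
        (by positivity)]
      have : 0 ≤ ((m : ℝ) - 1) * ((2 * m + 1) * (2 * m + 3)) :=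
        mul_nonneg (by linarith) (by positivity)
      nlinarith
    rw [Finset.sum_Icc_succ_top (by omega)]
    push_cast
    linarith

theorem one_div_sub_add_one_div_add_le (hg : 0 < g) (hi : 1 ≤ i) (h0 : 0 ≤ ν) (h1 : ν ≤ g) :
    1 / (2 * (2 * i * g - ν)) + 1 / (2 * (2 * i * g + ν)) ≤
      1 / (2 * (i : ℝ) * g) + (ν / g) ^ 2 / g * (1 / (2 * (i : ℝ) * (4 * (i : ℝ) ^ 2 - 1))) := by
  have : (0 : ℝ) < g := by exact_mod_cast hg
  have : (1 : ℝ) ≤ i := by exact_mod_cast hi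
  set r := ν / g with hr
  have hν : ν = r * g := by rw [hr]; field_simp
  have hr0 : 0 ≤ r := by positivity
  have hr1 : r ≤ 1 := (div_le_one₀ (by assumption)).mpr h1
  have : 0 < 2 * (i : ℝ) - r := by linarith
  have : 0 < 2 * (i : ℝ) + r := by linarith
  have : 0 < 4 * (i : ℝ) ^ 2 - 1 := by nlinarith
  have hexact : 1 / (2 * (2 * i * g - ν)) + 1 / (2 * (2 * i * g + ν)) =
      1 / (2 * (i : ℝ) * g) + r ^ 2 / g * (1 / (2 * (i : ℝ) * (4 * (i : ℝ) ^ 2 - r ^ 2))) := by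
    rw [hν, show 2 * (2 * (i : ℝ) * g - r * g) = 2 * g * (2 * i - r) by ring,
      show 2 * (2 * (i : ℝ) * g + r * g) = 2 * g * (2 * i + r) by ring,
      show 4 * (i : ℝ) ^ 2 - r ^ 2 = (2 * i - r) * (2 * i + r) by ring]
    field_simp
    ring
  rw [hexact]
  gcongr
  nlinarith

theorem sum_Ico_dirichlet_le_harmonic (hg : 0 < g) (hp : 0 < p) (hn : 2 * g * p ≤ n)
    (hδ : n * |δ| ≤ g) :
    ∑ i ∈ Ico 1 p, dirichlet n ((i : ℝ) / p - δ) ≤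
      (harmonic (p / 2) : ℝ) / (2 * g) + 5 / 24 * ((n * |δ| / g) ^ 2 / g) := by
  set c := (n * |δ| / g) ^ 2 / g
  have : 0 ≤ c := by positivity
  calc ∑ i ∈ Ico 1 p, dirichlet n ((i : ℝ) / p - δ)
      ≤ ∑ i ∈ Icc 1 (p / 2),
          (1 / (2 * (2 * i * g - n * |δ|)) + 1 / (2 * (2 * i * g + n * |δ|))) :=
        sum_Ico_dirichlet_le hg hp hn hδ
    _ ≤ ∑ i ∈ Icc 1 (p / 2),
          (1 / (2 * (i : ℝ) * g) + c * (1 / (2 * (i : ℝ) * (4 * (i : ℝ) ^ 2 - 1)))) :=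
        Finset.sum_le_sum fun i hi ↦ one_div_sub_add_one_div_add_le hg (Finset.mem_Icc.mp hi).1
          (by positivity) hδ
    _ = (harmonic (p / 2) : ℝ) / (2 * g) +
          c * ∑ i ∈ Icc 1 (p / 2), 1 / (2 * (i : ℝ) * (4 * (i : ℝ) ^ 2 - 1)) := by
        rw [Finset.sum_add_distrib, ← Finset.mul_sum, harmonic_eq_sum_Icc]
        push_cast
        rw [Finset.sum_div]
        congr 1
        exact Finset.sum_congr rfl fun i _ ↦ by field_simp
    _ ≤ (harmonic (p / 2) : ℝ) / (2 * g) + 5 / 24 * c := by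
        rw [mul_comm _ c]
        gcongr
        exact sum_inv_cubic_le _

theorem one_le_harmonic {m : ℕ} (hm : 0 < m) : 1 ≤ harmonic m := by
  have h := Finset.single_le_sum (f := fun i : ℕ ↦ ((i + 1 : ℕ) : ℚ)⁻¹) (s := range m)
    (fun i _ ↦ by positivity) (Finset.mem_range.mpr hm)
  simpa [harmonic] using h

theorem one_le_two_mul_mul_sub_one (hg : 0 < g) (hi : 1 ≤ i) : 1 ≤ 2 * i * g - 1 := by
  have : 1 ≤ i * g := Nat.mul_pos hi hg
  have : 2 * i * g = 2 * (i * g) := by ring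
  omega

theorem cast_two_mul_mul_sub_one (hg : 0 < g) (hi : 1 ≤ i) :
    ((2 * i * g - 1 : ℕ) : ℝ) = 2 * i * g - 1 := by
  have := one_le_two_mul_mul_sub_one hg hi
  rw [Nat.cast_sub (by omega)]
  push_cast
  ring

theorem leakageOne_nonneg (hg : 0 < g) : 0 ≤ leakageOne n g :=
  Finset.sum_nonneg fun _ _ ↦ lobeSup_nonneg (Nat.mul_pos (by omega) hg)

theorem leakageTwo_nonneg (hg : 0 < g) : 0 ≤ leakageTwo n g :=
  Finset.sum_nonneg fun _ hi ↦
    lobeSup_nonneg (one_le_two_mul_mul_sub_one hg (Finset.mem_Icc.mp hi).1)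

theorem pi_mul_leakageTwo_le (hg : 0 < g) (hn : n ≤ g ^ 2) : π * leakageTwo n g ≤ 1 / 4 := by
  have : (1 : ℝ) ≤ g := by exact_mod_cast hg
  have hterm : ∀ i ∈ Icc 1 ((n - 1) / (4 * g)),
      π * lobeSup (2 * i * g - 1) ≤ 1 / (2 * g - 1) := by
    intro i hi
    rw [Finset.mem_Icc] at hi
    have : (1 : ℝ) ≤ i := by exact_mod_cast hi.1
    refine (pi_mul_lobeSup_le (one_le_two_mul_mul_sub_one hg hi.1)).trans ?_
    rw [cast_two_mul_mul_sub_one hg hi.1]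
    exact one_div_le_one_div_of_le (by linarith) (by nlinarith)
  have hcard : 4 * (((n - 1) / (4 * g) : ℕ) : ℝ) ≤ g := by
    have : (n - 1) / (4 * g) ≤ g / 4 := by
      rw [← Nat.div_div_eq_div_mul, Nat.div_right_comm]
      refine Nat.div_le_div_right (Nat.div_le_of_le_mul ?_)
      calc n - 1 ≤ n := n.sub_le 1
        _ ≤ g * g := hn.trans_eq (sq g)
    exact_mod_cast (by omega : 4 * ((n - 1) / (4 * g)) ≤ g)
  calc π * leakageTwo n g
      ≤ ∑ _i ∈ Icc 1 ((n - 1) / (4 * g)), 1 / (2 * (g : ℝ) - 1) := by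
        rw [leakageTwo, Finset.mul_sum]
        exact Finset.sum_le_sum hterm
    _ = ((n - 1) / (4 * g) : ℕ) / (2 * (g : ℝ) - 1) := by simp [div_eq_mul_inv]
    _ ≤ 1 / 4 := by
        rw [div_le_iff₀ (by linarith)]
        linarith

theorem harmonic_add_le_pi_mul_leakageTwo (hg : 0 < g) (hp : 2 ≤ p) (hn : 2 * g * p < n) :
    (harmonic (p / 2) : ℝ) / (2 * g) + 1 / (8 * (g : ℝ) ^ 2) ≤ π * leakageTwo n g := by
  have : (1 : ℝ) ≤ g := by exact_mod_cast hg
  have hterm : ∀ i ∈ Icc 1 (p / 2),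
      1 / (2 * (i : ℝ) * g) + 1 / (8 * (i * g : ℝ) ^ 2) ≤ π * lobeSup (2 * i * g - 1) := by
    intro i hi
    rw [Finset.mem_Icc] at hi
    have : (1 : ℝ) ≤ i := by exact_mod_cast hi.1
    have : (1 : ℝ) ≤ i * g := by nlinarith
    refine le_trans ?_ (le_pi_mul_lobeSup (one_le_two_mul_mul_sub_one hg hi.1))
    rw [cast_two_mul_mul_sub_one hg hi.1, mul_assoc, div_add_div _ _ (by positivity)
      (by positivity), div_le_div_iff₀ (by positivity) (by linarith)]
    nlinarith
  have hsubset : p / 2 ≤ (n - 1) / (4 * g) := by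
    rw [Nat.le_div_iff_mul_le (by omega)]
    have : 2 * g * (2 * (p / 2)) ≤ 2 * g * p := by gcongr; omega
    have : p / 2 * (4 * g) = 2 * g * (2 * (p / 2)) := by ring
    omega
  have hfirst : 1 / (8 * (g : ℝ) ^ 2) ≤ ∑ i ∈ Icc 1 (p / 2), 1 / (8 * (i * g : ℝ) ^ 2) := by
    simpa only [Nat.cast_one, one_mul] using Finset.single_le_sum
      (f := fun i : ℕ ↦ 1 / (8 * (i * g : ℝ) ^ 2))
      (fun i _ ↦ by positivity) (Finset.mem_Icc.mpr ⟨le_rfl, (by omega : 1 ≤ p / 2)⟩)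
  calc (harmonic (p / 2) : ℝ) / (2 * g) + 1 / (8 * (g : ℝ) ^ 2)
      ≤ ∑ i ∈ Icc 1 (p / 2), (1 / (2 * (i : ℝ) * g) + 1 / (8 * (i * g : ℝ) ^ 2)) := by
        rw [Finset.sum_add_distrib, harmonic_eq_sum_Icc]
        push_cast
        rw [Finset.sum_div]
        refine add_le_add (Finset.sum_le_sum fun i _ ↦ le_of_eq ?_) hfirst
        field_simp
    _ ≤ ∑ i ∈ Icc 1 (p / 2), π * lobeSup (2 * i * g - 1) := Finset.sum_le_sum hterm
    _ ≤ ∑ i ∈ Icc 1 ((n - 1) / (4 * g)), π * lobeSup (2 * i * g - 1) :=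
        Finset.sum_le_sum_of_subset_of_nonneg (Finset.Icc_subset_Icc_right hsubset) fun i hi _ ↦
          mul_nonneg Real.pi_pos.le
            (lobeSup_nonneg (one_le_two_mul_mul_sub_one hg (Finset.mem_Icc.mp hi).1))
    _ = π * leakageTwo n g := by rw [leakageTwo, Finset.mul_sum]

theorem harmonic_add_le_pi_mul_leakageOne (hg : 5 ≤ g) (hp : 2 ≤ p) (hn : 2 * g * p < n) :
    (harmonic (p / 2) : ℝ) / (2 * g) + 2 / (5 * (g : ℝ)) ≤ π * leakageOne n g := by
  have : (5 : ℝ) ≤ g := by exact_mod_cast hg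
  have hterm (i : ℕ) : 1 / (2 * ((i : ℝ) + 1) * g) + 2 / (5 * ((i + 1) * (2 * i + 1) * (g : ℝ))) ≤
      π * lobeSup ((2 * i + 1) * g) := by
    refine le_trans ?_ (le_pi_mul_lobeSup (Nat.mul_pos (by omega) (by omega)))
    push_cast
    rw [show 1 / (2 * ((i : ℝ) + 1) * g) + 2 / (5 * ((i + 1) * (2 * i + 1) * (g : ℝ))) =
      (10 * i + 9) / (10 * (i + 1) * (2 * i + 1) * g) by field_simp; ring,
      div_le_div_iff₀ (by positivity) (by positivity)]
    nlinarith [i.cast_nonneg (α := ℝ)]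
  have hfirst : 2 / (5 * (g : ℝ)) ≤
      ∑ i ∈ range (p / 2), 2 / (5 * ((i + 1) * (2 * i + 1) * (g : ℝ))) := by
    simpa using Finset.single_le_sum
      (f := fun i : ℕ ↦ 2 / (5 * (((i : ℝ) + 1) * (2 * i + 1) * (g : ℝ))))
      (fun i _ ↦ by positivity) (Finset.mem_range.mpr (by omega : 0 < p / 2))
  have hhalf (s : ℕ) (hs : 2 * s ≤ p) :
      ∑ i ∈ range s, π / 2 * lobeSup ((2 * i + 1) * g) ≤ π / 2 * leakageOne n g :=
    sum_range_le_leakageOne (by omega) hn (by omega) fun i _ ↦ le_rfl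
  calc (harmonic (p / 2) : ℝ) / (2 * g) + 2 / (5 * (g : ℝ))
      ≤ ∑ i ∈ range (p / 2), (1 / (2 * ((i : ℝ) + 1) * g) +
          2 / (5 * ((i + 1) * (2 * i + 1) * (g : ℝ)))) := by
        rw [Finset.sum_add_distrib, harmonic]
        push_cast
        rw [Finset.sum_div]
        refine add_le_add (Finset.sum_le_sum fun i _ ↦ le_of_eq ?_) hfirst
        field_simp
    _ ≤ ∑ i ∈ range (p / 2), π * lobeSup ((2 * i + 1) * g) :=
        Finset.sum_le_sum fun i _ ↦ hterm i
    _ = 2 * ∑ i ∈ range (p / 2), π / 2 * lobeSup ((2 * i + 1) * g) := by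
        rw [Finset.mul_sum]
        exact Finset.sum_congr rfl fun i _ ↦ by ring
    _ ≤ π * leakageOne n g := by linarith [hhalf (p / 2) (by omega)]

theorem five_le_of_le_sq (hp : 2 ≤ p) (hn : 2 * g * p < n) (hng : n ≤ g ^ 2) : 5 ≤ g := by
  by_contra! h
  nlinarith

theorem sum_Ico_dirichlet_le_pi_mul_leakageOne (hg : 0 < g) (hp : 0 < p) (hn : 2 * g * p < n)
    (hng : n ≤ g ^ 2) (hδ : n * |δ| ≤ g) :
    ∑ i ∈ Ico 1 p, dirichlet n ((i : ℝ) / p - δ) ≤ π * leakageOne n g := by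
  have : (0 : ℝ) < g := by exact_mod_cast hg
  rcases (Nat.succ_le_of_lt hp).eq_or_lt with rfl | hp
  · simpa using mul_nonneg Real.pi_pos.le (leakageOne_nonneg hg)
  calc ∑ i ∈ Ico 1 p, dirichlet n ((i : ℝ) / p - δ)
      ≤ (harmonic (p / 2) : ℝ) / (2 * g) + 5 / 24 * ((n * |δ| / g) ^ 2 / g) :=
        sum_Ico_dirichlet_le_harmonic hg (by omega) hn.le hδ
    _ ≤ (harmonic (p / 2) : ℝ) / (2 * g) + 5 / 24 * (1 ^ 2 / g) := by
        gcongr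
        exact (div_le_one₀ (by assumption)).mpr hδ
    _ ≤ (harmonic (p / 2) : ℝ) / (2 * g) + 2 / (5 * (g : ℝ)) := by
        gcongr
        rw [mul_div_assoc', div_le_div_iff₀ (by positivity) (by positivity)]
        linarith
    _ ≤ π * leakageOne n g :=
        harmonic_add_le_pi_mul_leakageOne (five_le_of_le_sq hp hn hng) hp hn

theorem sum_Ico_dirichlet_le_pi_mul_leakageTwo (hg : 2 ≤ g) (hp : 0 < p) (hn : 2 * g * p < n)
    (hδ : n * |δ| ≤ 1) :
    ∑ i ∈ Ico 1 p, dirichlet n ((i : ℝ) / p - δ) ≤ π * leakageTwo n g := by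
  have : (2 : ℝ) ≤ g := by exact_mod_cast hg
  rcases (Nat.succ_le_of_lt hp).eq_or_lt with rfl | hp
  · simpa using mul_nonneg Real.pi_pos.le (leakageTwo_nonneg (by omega))
  calc ∑ i ∈ Ico 1 p, dirichlet n ((i : ℝ) / p - δ)
      ≤ (harmonic (p / 2) : ℝ) / (2 * g) + 5 / 24 * ((n * |δ| / g) ^ 2 / g) :=
        sum_Ico_dirichlet_le_harmonic (by omega) (by omega) hn.le (by linarith)
    _ ≤ (harmonic (p / 2) : ℝ) / (2 * g) + 5 / 24 * ((1 / g) ^ 2 / g) := by gcongr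
    _ ≤ (harmonic (p / 2) : ℝ) / (2 * g) + 1 / (8 * (g : ℝ) ^ 2) := by
        gcongr
        rw [show 5 / 24 * ((1 / g) ^ 2 / g) = 5 / (24 * (g : ℝ) ^ 3) by field_simp,
          div_le_div_iff₀ (by positivity) (by positivity)]
        nlinarith [sq_nonneg (g : ℝ)]
    _ ≤ π * leakageTwo n g := harmonic_add_le_pi_mul_leakageTwo (by omega) hp hn

theorem sum_Ico_dirichlet_le_pi_mul_leakageTwo_add (hg : 0 < g) (hp : 0 < p) (hn : 2 * g * p < n)
    (hδ : n * |δ| ≤ g) :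
    ∑ i ∈ Ico 1 p, dirichlet n ((i : ℝ) / p - δ) ≤ π * leakageTwo n g + 1 / 2 := by
  have : (1 : ℝ) ≤ g := by exact_mod_cast hg
  rcases (Nat.succ_le_of_lt hp).eq_or_lt with rfl | hp
  · simpa using add_nonneg (mul_nonneg Real.pi_pos.le (leakageTwo_nonneg hg)) (by norm_num)
  have hnear := sum_Ico_dirichlet_le_harmonic hg (by omega) hn.le hδ
  have hcorrection : (n * |δ| / g) ^ 2 / g ≤ 1 := by
    refine div_le_one_of_le₀ (le_trans ?_ (by assumption)) (by positivity)
    exact pow_le_one₀ (by positivity) ((div_le_one₀ (by positivity)).mpr hδ)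
  have hlead := harmonic_add_le_pi_mul_leakageTwo hg hp hn
  have : 0 ≤ 1 / (8 * (g : ℝ) ^ 2) := by positivity
  linarith

end Leakage

/-! ### The periodogram of a periodic signal -/

/-- The discrete Fourier transform, at the frequency `v`, of the values of a complex signal `f` at
the epochs of arm `k`. Its modulus is the periodogram. -/
def transform (n k : ℕ) (f : ℕ → ℂ) (v : ℝ) : ℂ :=
  (1 / (n : ℂ)) * ∑ s ∈ Icc (n * k + 1) (n * (k + 1)),
    f s * Complex.exp (-(2 * π * Complex.I * v * s))

theorem norm_transform_ofReal (n k : ℕ) (y : ℕ → ℝ) (v : ℝ) :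
    ‖transform n k (fun s ↦ y s) v‖ = periodogram n k y v := rfl

theorem continuous_periodogram (n k : ℕ) (y : ℕ → ℝ) : Continuous (periodogram n k y) := by
  unfold periodogram
  fun_prop

theorem transform_sub (n k : ℕ) (f h : ℕ → ℂ) (v : ℝ) :
    transform n k (fun s ↦ f s - h s) v = transform n k f v - transform n k h v := by
  simp only [transform, sub_mul, Finset.sum_sub_distrib, mul_sub]

theorem transform_sum_const_mul {ι : Type*} (t : Finset ι) (a : ι → ℂ) (f : ι → ℕ → ℂ)
    (n k : ℕ) (v : ℝ) :
    transform n k (fun s ↦ ∑ j ∈ t, a j * f j s) v = ∑ j ∈ t, a j * transform n k (f j) v := by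
  simp only [transform, Finset.sum_mul, Finset.mul_sum]
  rw [Finset.sum_comm]
  refine Finset.sum_congr rfl fun j _ ↦ Finset.sum_congr rfl fun s _ ↦ ?_
  ring

theorem sum_Icc_epochs {M : Type*} [AddCommMonoid M] (n k : ℕ) (f : ℕ → M) :
    ∑ s ∈ Icc (n * k + 1) (n * (k + 1)), f s = ∑ i ∈ range n, f (n * k + 1 + i) := by
  rw [← Finset.Ico_add_one_right_eq_Icc, Finset.sum_Ico_eq_sum_range]
  congr 2
  rw [mul_add]
  lia

theorem norm_transform_exp (n k : ℕ) (x v : ℝ) :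
    ‖transform n k (fun s ↦ Complex.exp (2 * π * Complex.I * x * s)) v‖ = dirichlet n (x - v) := by
  have shift (i : ℕ) : Complex.exp (2 * π * Complex.I * x * (n * k + 1 + i : ℕ)) *
        Complex.exp (-(2 * π * Complex.I * v * (n * k + 1 + i : ℕ))) =
      Complex.exp (2 * π * Complex.I * (x - v : ℝ) * (n * k + 1 : ℕ)) *
        Complex.exp (2 * π * Complex.I * (x - v : ℝ) * i) := by
    rw [← Complex.exp_add, ← Complex.exp_add]
    congr 1
    push_cast
    ring
  simp_rw [transform, sum_Icc_epochs, shift]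
  rw [← Finset.mul_sum, mul_left_comm, norm_mul, norm_exp_two_pi_mul, one_mul]
  rfl

section Magnitude

variable (m : ℕ → ℝ) {p j : ℕ}

theorem finite_presentMagnitudes (p : ℕ) : (presentMagnitudes m p).Finite := by
  refine ((range p).finite_toSet.image fun j ↦ ‖fourierCoeff m p j‖).subset ?_
  rintro _ ⟨_, j, hj, rfl⟩
  exact ⟨j, by simpa using hj, rfl⟩

theorem maxMagnitude_nonneg (p : ℕ) : 0 ≤ maxMagnitude m p :=
  Real.sSup_nonneg fun _ h ↦ h.1.le

theorem norm_fourierCoeff_le_maxMagnitude (hj : j < p) :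
    ‖fourierCoeff m p j‖ ≤ maxMagnitude m p := by
  rcases (norm_nonneg (fourierCoeff m p j)).eq_or_lt with h | h
  · exact h ▸ maxMagnitude_nonneg m p
  · exact le_csSup (finite_presentMagnitudes m p).bddAbove ⟨h, j, hj, rfl⟩

theorem fourierCoeff_sub (hp : 0 < p) (hj : j ≤ p) :
    fourierCoeff m p (p - j) = (starRingEnd ℂ) (fourierCoeff m p j) := by
  have : (p : ℂ) ≠ 0 := by exact_mod_cast hp.ne'
  simp only [fourierCoeff, map_mul, map_div₀, map_one, Complex.conj_natCast, map_sum,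
    ← Complex.exp_conj, Complex.conj_I, Complex.conj_ofReal, map_ofNat, map_neg]
  congr 1
  refine Finset.sum_congr rfl fun t _ ↦ ?_
  congr 1
  rw [Complex.exp_eq_exp_iff_exists_int]
  refine ⟨-(t : ℤ), ?_⟩
  push_cast [hj]
  field_simp
  ring

theorem norm_fourierCoeff_sub (hp : 0 < p) (hj : j ≤ p) :
    ‖fourierCoeff m p (p - j)‖ = ‖fourierCoeff m p j‖ := by
  rw [fourierCoeff_sub m hp hj, Complex.norm_conj]

theorem maxMagnitude_eq_zero_or_exists (hp : 0 < p) :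
    maxMagnitude m p = 0 ∨ ∃ j, 2 * j ≤ p ∧ ‖fourierCoeff m p j‖ = maxMagnitude m p := by
  rcases (presentMagnitudes m p).eq_empty_or_nonempty with h | h
  · exact .inl (by rw [maxMagnitude, h, Real.sSup_empty])
  obtain ⟨_, j, hj, hmax⟩ := h.csSup_mem (finite_presentMagnitudes m p)
  rcases le_total (2 * j) p with hjp | hjp
  · exact .inr ⟨j, hjp, hmax.symm⟩
  · exact .inr ⟨p - j, by lia, (norm_fourierCoeff_sub m hp hj.le).trans hmax.symm⟩

end Magnitude

section PeriodicSignal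

variable {m : ℕ → ℝ} {p c : ℕ}

theorem transform_eq_sum_fourierCoeff (hp : 0 < p) (hm : Function.Periodic m p) (n k : ℕ) (v : ℝ) :
    transform n k (fun s ↦ m s) v = ∑ j ∈ range p, fourierCoeff m p j *
      transform n k (fun s ↦ Complex.exp (2 * π * Complex.I * (j / p : ℝ) * s)) v := by
  rw [← transform_sum_const_mul]
  congr 1
  ext s
  rw [fourierCoeff_representation m p hp hm]
  push_cast
  rfl

theorem abs_norm_sum_sub_le {ι : Type*} [DecidableEq ι] {s : Finset ι} {c : ι} (hc : c ∈ s)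
    (f : ι → ℂ) : |‖∑ j ∈ s, f j‖ - ‖f c‖| ≤ ∑ j ∈ s.erase c, ‖f j‖ := by
  refine (abs_norm_sub_norm_le _ _).trans ?_
  rw [← Finset.add_sum_erase s f hc, add_sub_cancel_left]
  exact norm_sum_le _ _

theorem sum_erase_dirichlet (n : ℕ) (hc : c < p) (v : ℝ) :
    ∑ j ∈ (range p).erase c, dirichlet n (j / p - v) =
      ∑ i ∈ Ico 1 p, dirichlet n (i / p - (v - c / p)) := by
  have hp : (p : ℝ) ≠ 0 := by exact_mod_cast (by lia : p ≠ 0)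
  rw [sum_erase_of_periodic (f := fun j : ℕ ↦ dirichlet n (j / p - v)) (fun i ↦ ?_) hc]
  · refine Finset.sum_congr rfl fun i _ ↦ ?_
    congr 1
    push_cast
    ring
  · beta_reduce
    rw [← dirichlet_add_one n (i / p - v)]
    congr 1
    push_cast
    field_simp
    ring

theorem abs_periodogram_sub_le (hc : c < p) (hm : Function.Periodic m p) (n k : ℕ) (v : ℝ) :
    |periodogram n k m v - ‖fourierCoeff m p c‖ * dirichlet n (v - c / p)| ≤
      maxMagnitude m p * ∑ i ∈ Ico 1 p, dirichlet n (i / p - (v - c / p)) := by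
  have split := abs_norm_sum_sub_le (Finset.mem_range.mpr hc) fun j ↦ fourierCoeff m p j *
    transform n k (fun s ↦ Complex.exp (2 * π * Complex.I * (j / p : ℝ) * s)) v
  simp only [← transform_eq_sum_fourierCoeff (by lia) hm, norm_mul, norm_transform_exp,
    norm_transform_ofReal] at split
  rw [← dirichlet_neg n (c / p - v), neg_sub] at split
  refine split.trans ?_
  rw [← sum_erase_dirichlet n hc, Finset.mul_sum]
  refine Finset.sum_le_sum fun j hj ↦ mul_le_mul_of_nonneg_right ?_ (dirichlet_nonneg n _)
  exact norm_fourierCoeff_le_maxMagnitude m (Finset.mem_range.mp (Finset.mem_of_mem_erase hj))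

theorem exists_abs_sub_div_le (hp : 0 < p) {v : ℝ} (h0 : 0 ≤ v) (h1 : v ≤ 1 / 2) :
    ∃ c : ℕ, 2 * c ≤ p ∧ p * |v - c / p| ≤ 1 / 2 := by
  have hp' : (0 : ℝ) < p := by exact_mod_cast hp
  have scale (c : ℕ) : p * |v - c / p| = |p * v - c| := by
    rw [← abs_of_pos hp', ← abs_mul, abs_of_pos hp', mul_sub, mul_div_cancel₀ _ hp'.ne']
  simp only [scale]
  rcases le_or_gt (p * v) (1 / 2) with h | h
  · exact ⟨0, by lia, by rwa [Nat.cast_zero, sub_zero, abs_of_nonneg (by positivity)]⟩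
  -- Ties are rounded down, as `v = 1 / 2` and `p` odd require.
  · have lower := Nat.le_ceil (p * v - 1 / 2)
    have upper := Nat.ceil_lt_add_one (by linarith : 0 ≤ p * v - 1 / 2)
    refine ⟨⌈p * v - 1 / 2⌉₊, ?_, abs_le.mpr ⟨by linarith, by linarith⟩⟩
    suffices ((2 * ⌈p * v - 1 / 2⌉₊ : ℕ) : ℝ) < (p + 1 : ℕ) by
      exact Nat.lt_succ_iff.mp (by exact_mod_cast this)
    push_cast
    nlinarith

end PeriodicSignal

/-! ### The periodogram of the mean rewards -/

/-- The bound, in multiples of `maxMagnitude`, for the periodogram of the mean rewards. -/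
def gainBound (n g : ℕ) : ℝ := max (π * leakageOne n g) (π * leakageTwo n g + 1)

section Signal

variable {n g k p c j : ℕ} {m : ℕ → ℝ} {v : ℝ}

theorem dirichlet_add_sum_le_pi_mul_leakageOne (hg : 0 < g) (hp : 0 < p) (hn : 2 * g * p < n)
    (hv : p * |v - c / p| ≤ 1 / 2) (hfar : g ≤ n * |v - c / p|) :
    dirichlet n (v - c / p) + ∑ i ∈ Ico 1 p, dirichlet n (i / p - (v - c / p)) ≤
      π * leakageOne n g := by
  have hsum := sum_range_dirichlet_le hg hp hn hfar hv
  rwa [Finset.range_eq_Ico, Finset.sum_eq_sum_Ico_succ_bot hp, Nat.cast_zero, zero_div, zero_sub,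
    dirichlet_neg, zero_add] at hsum

theorem dirichlet_add_sum_le_pi_mul_leakageTwo_add (hg : 2 ≤ g) (hp : 0 < p) (hn : 2 * g * p < n)
    (hv : p * |v - c / p| ≤ 1 / 2) (hnear : n * |v - c / p| ≤ g) :
    dirichlet n (v - c / p) + ∑ i ∈ Ico 1 p, dirichlet n (i / p - (v - c / p)) ≤
      π * leakageTwo n g + 1 := by
  rcases le_or_gt (n * |v - c / p|) 1 with h1 | h1
  · linarith [sum_Ico_dirichlet_le_pi_mul_leakageTwo hg hp hn h1, dirichlet_le_one n (v - c / p)]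
  have hpos : 0 < |v - c / p| := pos_of_mul_pos_right (by linarith) n.cast_nonneg
  have hhalf : |v - c / p| ≤ 1 / 2 :=
    (le_mul_of_one_le_left hpos.le (by exact_mod_cast hp)).trans hv
  have hmain : dirichlet n (v - c / p) ≤ 1 / 2 := by
    rw [← dirichlet_abs]
    refine (dirichlet_le_inv (by lia) hpos hhalf).trans ?_
    gcongr
    linarith
  linarith [sum_Ico_dirichlet_le_pi_mul_leakageTwo_add (by lia) hp hn hnear]

theorem periodogram_le_mul_of_dirichlet_add_sum_le (hc : c < p) (hm : Function.Periodic m p)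
    (k : ℕ) {M : ℝ}
    (hM : dirichlet n (v - c / p) + ∑ i ∈ Ico 1 p, dirichlet n (i / p - (v - c / p)) ≤ M) :
    periodogram n k m v ≤ maxMagnitude m p * M := by
  have hdev := (abs_le.mp (abs_periodogram_sub_le hc hm n k v)).2
  have hmain := mul_le_mul_of_nonneg_right (norm_fourierCoeff_le_maxMagnitude m hc)
    (dirichlet_nonneg n (v - c / p))
  have htotal := mul_le_mul_of_nonneg_left hM (maxMagnitude_nonneg m p)
  linarith

theorem periodogram_le_of_eq_zero_or_le (hg : 0 < g) (hp : 0 < p) (hn : 2 * g * p < n)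
    (hng : n ≤ g ^ 2) (hm : Function.Periodic m p) (k : ℕ) (hc : 2 * c ≤ p)
    (hv : p * |v - c / p| ≤ 1 / 2) (hfar : fourierCoeff m p c = 0 ∨ g ≤ n * |v - c / p|) :
    periodogram n k m v ≤ maxMagnitude m p * (π * leakageOne n g) := by
  rcases le_or_gt (g : ℝ) (n * |v - c / p|) with h | h
  · exact periodogram_le_mul_of_dirichlet_add_sum_le (by lia) hm k
      (dirichlet_add_sum_le_pi_mul_leakageOne hg hp hn hv h)
  · have hdev := (abs_le.mp (abs_periodogram_sub_le (c := c) (by lia) hm n k v)).2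
    rw [hfar.resolve_right h.not_ge, norm_zero, zero_mul, sub_zero] at hdev
    exact hdev.trans (mul_le_mul_of_nonneg_left
      (sum_Ico_dirichlet_le_pi_mul_leakageOne hg hp hn hng h.le) (maxMagnitude_nonneg m p))

theorem periodogram_le_mul_gainBound (hg : 2 ≤ g) (hp : 0 < p) (hn : 2 * g * p < n)
    (hm : Function.Periodic m p) (k : ℕ) (h0 : 0 ≤ v) (h1 : v ≤ 1 / 2) :
    periodogram n k m v ≤ maxMagnitude m p * gainBound n g := by
  obtain ⟨c, hc, hv⟩ := exists_abs_sub_div_le hp h0 h1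
  refine periodogram_le_mul_of_dirichlet_add_sum_le (c := c) (by lia) hm k ?_
  rcases le_total (g : ℝ) (n * |v - c / p|) with h | h
  · exact (dirichlet_add_sum_le_pi_mul_leakageOne (by lia) hp hn hv h).trans (le_max_left _ _)
  · exact (dirichlet_add_sum_le_pi_mul_leakageTwo_add hg hp hn hv h).trans (le_max_right _ _)

theorem le_periodogram_div (hn : 0 < n) (hj : j < p) (hm : Function.Periodic m p) (k : ℕ) :
    ‖fourierCoeff m p j‖ - maxMagnitude m p * ∑ i ∈ Ico 1 p, dirichlet n (i / p - 0) ≤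
      periodogram n k m (j / p) := by
  have hdev := (abs_le.mp (abs_periodogram_sub_le hj hm n k (j / p))).1
  rw [sub_self, dirichlet_zero hn.ne', mul_one] at hdev
  linarith

theorem le_periodogram_div_of_leakageTwo (hg : 2 ≤ g) (hn : 2 * g * p < n)
    (hj : j < p) (hm : Function.Periodic m p) (k : ℕ) :
    ‖fourierCoeff m p j‖ - maxMagnitude m p * (π * leakageTwo n g) ≤
      periodogram n k m (j / p) := by
  have hleak := sum_Ico_dirichlet_le_pi_mul_leakageTwo (δ := 0) hg (by lia) hn (by simp)
  have := mul_le_mul_of_nonneg_left hleak (maxMagnitude_nonneg m p)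
  linarith [le_periodogram_div (by lia : 0 < n) hj hm k]

end Signal

/-! ### Arms with little noise -/

/-- The factor with which the threshold weighs the supremum of the periodogram. -/
def leakageRatio (n g : ℕ) : ℝ := π * leakageOne n g / (1 - π * leakageTwo n g)

/-- The rewards `y` of arm `k` are means `m` satisfying the assumptions of the theorem up to noise
whose transform stays below `3 / 4` of the noise level. -/
structure QuietArm (n g k p : ℕ) (σ H : ℝ) (m y : ℕ → ℝ) : Prop where
  two_le : 2 ≤ g
  le_sq : n ≤ g ^ 2
  period : IsMinimalPeriod m p
  period_lt : 2 * g * p < n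
  magnitude : MagnitudeCondition n g σ H m p
  noise_lt : ∀ v, ‖transform n k (fun s ↦ y s - m s) v‖ < 3 / 4 * noiseLevel n σ H

theorem five_twelfths_mul_sq_div_le {g ν : ℝ} (hg : 5 ≤ g) (h2 : 2 ≤ ν) (hν : ν ≤ g) :
    5 / 12 * (ν / g) ^ 2 ≤ 2 / 3 - 1 / ν := by
  have hν0 : 0 < ν := by linarith
  rcases le_total ν 5 with h5 | h5
  · calc 5 / 12 * (ν / g) ^ 2 ≤ 5 / 12 * (ν / 5) ^ 2 := by gcongr
      _ ≤ (2 / 3 * ν - 1) / ν := by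
        rw [le_div_iff₀ hν0]
        nlinarith [mul_nonneg (sub_nonneg.mpr h2) (sub_nonneg.mpr h5)]
      _ = 2 / 3 - 1 / ν := by field_simp
  · have hsq : (ν / g) ^ 2 ≤ 1 :=
      pow_le_one₀ (by positivity) ((div_le_one (by linarith)).mpr hν)
    have hinv : 1 / ν ≤ 1 / 5 := one_div_le_one_div_of_le (by norm_num) h5
    linarith

theorem add_leakage_le_mul {g ν l : ℝ} (hg : 5 ≤ g) (h2 : 2 ≤ ν) (hν : ν ≤ g)
    (hl : 1 / (2 * g) ≤ l) :
    l + (l + 5 / 24 * ((ν / g) ^ 2 / g)) ≤ 8 / 3 * l * (1 - 3 / (8 * ν)) := by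
  have hl0 : 0 ≤ l := le_trans (by positivity) hl
  calc l + (l + 5 / 24 * ((ν / g) ^ 2 / g))
      = l + (l + 1 / (2 * g) * (5 / 12 * (ν / g) ^ 2)) := by
        field_simp
        ring
    _ ≤ l + (l + l * (2 / 3 - 1 / ν)) := by
        gcongr
        exact five_twelfths_mul_sq_div_le hg h2 hν
    _ = 8 / 3 * l * (1 - 3 / (8 * ν)) := by
        field_simp
        ring

section Magnitude

variable {n g p j : ℕ} {σ H : ℝ} {m : ℕ → ℝ}

theorem MagnitudeCondition.le_norm_fourierCoeff (h : MagnitudeCondition n g σ H m p) (hj : j < p)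
    (hj0 : fourierCoeff m p j ≠ 0) :
    (2 * leakageRatio n g + 2) * noiseLevel n σ H +
      max (8 * π / 3 * leakageTwo n g) (leakageRatio n g * gainBound n g + π * leakageTwo n g) *
        maxMagnitude m p ≤ ‖fourierCoeff m p j‖ := by
  have hmin : minMagnitude m p ≤ (‖fourierCoeff m p j‖ : ℝ) :=
    sInf_le ⟨_, ⟨norm_pos_iff.mpr hj0, j, hj, rfl⟩, rfl⟩
  rw [leakageRatio, ← mul_div_assoc, ← mul_assoc]
  exact EReal.coe_le_coe_iff.mp (h.trans hmin)

theorem div_mem_Icc (hj : 2 * j ≤ p) : (j : ℝ) / p ∈ Set.Icc (0 : ℝ) (1 / 2) := by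
  refine ⟨by positivity, div_le_of_le_mul₀ p.cast_nonneg (by norm_num) ?_⟩
  have : (2 * j : ℝ) ≤ p := by exact_mod_cast hj
  linarith

end Magnitude

namespace QuietArm

variable {n g k p j : ℕ} {σ H v w : ℝ} {m y : ℕ → ℝ}

theorem period_pos (h : QuietArm n g k p σ H m y) : 0 < p := h.period.1.1

theorem radius_pos (h : QuietArm n g k p σ H m y) : 0 < g := two_pos.trans_le h.two_le

theorem length_pos (h : QuietArm n g k p σ H m y) : 0 < n := (Nat.zero_le _).trans_lt h.period_lt

theorem periodic (h : QuietArm n g k p σ H m y) : Function.Periodic m p := h.period.1.2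

theorem noiseLevel_pos (h : QuietArm n g k p σ H m y) : 0 < noiseLevel n σ H := by
  linarith [(norm_nonneg _).trans_lt (h.noise_lt 0)]

theorem leakageRatio_nonneg (h : QuietArm n g k p σ H m y) : 0 ≤ leakageRatio n g :=
  div_nonneg (mul_nonneg Real.pi_pos.le (leakageOne_nonneg h.radius_pos))
    (by linarith [pi_mul_leakageTwo_le h.radius_pos h.le_sq])

theorem abs_periodogram_sub_lt (h : QuietArm n g k p σ H m y) (v : ℝ) :
    |periodogram n k y v - periodogram n k m v| < 3 / 4 * noiseLevel n σ H := by
  rw [← norm_transform_ofReal, ← norm_transform_ofReal]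
  refine (abs_norm_sub_norm_le _ _).trans_lt ?_
  rw [← transform_sub]
  exact h.noise_lt v

theorem periodogram_le (h : QuietArm n g k p σ H m y) (hv : v ∈ Set.Icc (0 : ℝ) (1 / 2)) :
    periodogram n k y v ≤ 3 / 4 * noiseLevel n σ H + maxMagnitude m p * gainBound n g := by
  have hnoise := (abs_lt.mp (h.abs_periodogram_sub_lt v)).2
  have hsignal :=
    periodogram_le_mul_gainBound h.two_le h.period_pos h.period_lt h.periodic k hv.1 hv.2
  linarith

theorem lt_periodogram_div (h : QuietArm n g k p σ H m y) (hj : j < p) :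
    ‖fourierCoeff m p j‖ - maxMagnitude m p * (π * leakageTwo n g) - 3 / 4 * noiseLevel n σ H <
      periodogram n k y (j / p) := by
  have hnoise := (abs_lt.mp (h.abs_periodogram_sub_lt (j / p))).1
  have hsignal := le_periodogram_div_of_leakageTwo h.two_le h.period_lt hj h.periodic k
  linarith

theorem mul_maxMagnitude_le (h : QuietArm n g k p σ H m y) :
    (1 - π * leakageTwo n g) * maxMagnitude m p ≤
      noiseLevel n σ H + sSup (periodogram n k y '' Set.Icc (0 : ℝ) (1 / 2)) := by
  have he := h.noiseLevel_pos
  rcases maxMagnitude_eq_zero_or_exists m h.period_pos with h0 | ⟨j, hj, hmax⟩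
  · rw [h0, mul_zero]
    refine add_nonneg he.le (Real.sSup_nonneg ?_)
    rintro _ ⟨v, -, rfl⟩
    exact norm_nonneg _
  · have hsup := le_csSup ⟨_, Set.forall_mem_image.mpr fun v ↦ h.periodogram_le⟩
      (Set.mem_image_of_mem (periodogram n k y) (div_mem_Icc hj))
    have hpeak := h.lt_periodogram_div (by have := h.period_pos; lia : j < p)
    rw [hmax] at hpeak
    linarith

theorem le_threshold (h : QuietArm n g k p σ H m y) :
    noiseLevel n σ H + maxMagnitude m p * (π * leakageOne n g) ≤
      threshold n g σ H (periodogram n k y) := by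
  have hpos : 0 < 1 - π * leakageTwo n g := by
    linarith [pi_mul_leakageTwo_le h.radius_pos h.le_sq]
  have hratio : maxMagnitude m p * (π * leakageOne n g) =
      leakageRatio n g * ((1 - π * leakageTwo n g) * maxMagnitude m p) := by
    rw [leakageRatio]
    field_simp
  rw [hratio]
  exact add_le_add le_rfl (mul_le_mul_of_nonneg_left h.mul_maxMagnitude_le h.leakageRatio_nonneg)

theorem threshold_le (h : QuietArm n g k p σ H m y) :
    threshold n g σ H (periodogram n k y) ≤ noiseLevel n σ H +
      leakageRatio n g * (2 * noiseLevel n σ H + maxMagnitude m p * gainBound n g) := by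
  have he := h.noiseLevel_pos
  have hsup : sSup (periodogram n k y '' Set.Icc (0 : ℝ) (1 / 2)) ≤
      3 / 4 * noiseLevel n σ H + maxMagnitude m p * gainBound n g :=
    csSup_le ⟨_, 0, ⟨le_rfl, by norm_num⟩, rfl⟩
      (Set.forall_mem_image.mpr fun v ↦ h.periodogram_le)
  exact add_le_add le_rfl (mul_le_mul_of_nonneg_left (by linarith) h.leakageRatio_nonneg)

theorem div_mem_initialDomain (h : QuietArm n g k p σ H m y) (hj1 : 1 ≤ j) (hj : 2 * j ≤ p)
    (hj0 : fourierCoeff m p j ≠ 0) :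
    (j : ℝ) / p ∈ initialDomain n g σ H (periodogram n k y) := by
  refine ⟨?_, (div_mem_Icc hj).2, h.threshold_le.trans_lt ?_⟩
  · have : (0 : ℝ) < p := by exact_mod_cast h.period_pos
    have : (0 : ℝ) < n := by exact_mod_cast h.length_pos
    rw [div_le_div_iff₀ (by assumption) (by assumption)]
    have := h.period_lt
    exact_mod_cast (by nlinarith : g * p ≤ j * n)
  · have he := h.noiseLevel_pos
    have hpeak := h.lt_periodogram_div (by lia : j < p)
    have hcoeff := h.magnitude.le_norm_fourierCoeff (by lia) hj0
    have hmax := mul_le_mul_of_nonneg_right (le_max_right (8 * π / 3 * leakageTwo n g)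
      (leakageRatio n g * gainBound n g + π * leakageTwo n g)) (maxMagnitude_nonneg m p)
    linarith

theorem exists_near_of_mem_initialDomain (h : QuietArm n g k p σ H m y)
    (hv : v ∈ initialDomain n g σ H (periodogram n k y)) :
    ∃ j : ℕ, 1 ≤ j ∧ 2 * j ≤ p ∧ fourierCoeff m p j ≠ 0 ∧ n * |v - j / p| < g := by
  obtain ⟨hgv, hv2, hthr⟩ := hv
  have : (0 : ℝ) < n := by exact_mod_cast h.length_pos
  have hv0 : 0 ≤ v := le_trans (by positivity) hgv
  obtain ⟨c, hc, hcv⟩ := exists_abs_sub_div_le h.period_pos hv0 hv2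
  obtain ⟨hc0, hnear⟩ : fourierCoeff m p c ≠ 0 ∧ n * |v - c / p| < g := by
    rw [← not_le, ← not_or]
    intro hfar
    have hsignal := periodogram_le_of_eq_zero_or_le h.radius_pos h.period_pos h.period_lt h.le_sq
      h.periodic k hc hcv hfar
    linarith [h.le_threshold, (abs_lt.mp (h.abs_periodogram_sub_lt v)).2, h.noiseLevel_pos]
  refine ⟨c, Nat.one_le_iff_ne_zero.mpr ?_, hc, hc0, hnear⟩
  rintro rfl
  rw [Nat.cast_zero, zero_div, sub_zero, abs_of_nonneg hv0] at hnear
  rw [div_le_iff₀ (by assumption)] at hgv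
  linarith

theorem two_mul_noiseLevel_add_le (h : QuietArm n g k p σ H m y) (hp : 2 ≤ p) (hj : j < p)
    (hj0 : fourierCoeff m p j ≠ 0) :
    2 * noiseLevel n σ H + 8 / 3 * ((harmonic (p / 2) : ℝ) / (2 * g)) * maxMagnitude m p ≤
      ‖fourierCoeff m p j‖ := by
  refine le_trans ?_ (h.magnitude.le_norm_fourierCoeff hj hj0)
  refine add_le_add (mul_le_mul_of_nonneg_right ?_ h.noiseLevel_pos.le)
    (mul_le_mul_of_nonneg_right ?_ (maxMagnitude_nonneg m p))
  · linarith [h.leakageRatio_nonneg]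
  · refine le_trans ?_ (le_max_left _ _)
    have : 0 < 1 / (8 * (g : ℝ) ^ 2) := by
      have := h.radius_pos
      positivity
    linarith [harmonic_add_le_pi_mul_leakageTwo h.radius_pos hp h.period_lt]

theorem dirichlet_le_of_two_le (h : QuietArm n g k p σ H m y) (hp : 2 ≤ p)
    (hv : n * |v| < g) (h2 : 2 ≤ n * |v|) : dirichlet n v ≤ 3 / (8 * (n * |v|)) := by
  have : (4 * g : ℝ) < n := by
    have := h.period_lt
    exact_mod_cast (by nlinarith : 4 * g < n)
  rw [← dirichlet_abs]
  refine dirichlet_le_three_eighths h.length_pos (pos_of_mul_pos_right ?_ n.cast_nonneg) ?_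
  · linarith
  · by_contra! hquarter
    nlinarith

/-- The leakage bounds differ by `O((ν / g) ^ 2 / g)` between `j / p` and a frequency at distance
`ν / n`, whereas the contribution of `j / p` itself drops to a fraction `3 / (8 ν)`. -/
theorem lt_two_of_periodogram_le (h : QuietArm n g k p σ H m y) (hp : 2 ≤ p) (hj : j < p)
    (hj0 : fourierCoeff m p j ≠ 0) (hw : n * |w - j / p| < g)
    (hle : periodogram n k y (j / p) ≤ periodogram n k y w) : n * |w - j / p| < 2 := by
  by_contra! h2
  have hg5 := five_le_of_le_sq hp h.period_lt h.le_sq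
  set ν := n * |w - j / p|
  set l := (harmonic (p / 2) : ℝ) / (2 * g)
  set B := maxMagnitude m p
  set e := noiseLevel n σ H
  have hB : 0 ≤ B := maxMagnitude_nonneg m p
  have he : 0 < e := h.noiseLevel_pos
  have hnoise_peak := (abs_lt.mp (h.abs_periodogram_sub_lt (j / p))).1
  have hnoise := (abs_lt.mp (h.abs_periodogram_sub_lt w)).2
  have hpeak : ‖fourierCoeff m p j‖ - B * l ≤ periodogram n k m (j / p) := by
    have hleak : ∑ i ∈ Ico 1 p, dirichlet n (i / p - 0) ≤ l := by
      simpa using sum_Ico_dirichlet_le_harmonic (δ := 0) h.radius_pos h.period_pos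
        h.period_lt.le (by simp)
    exact (sub_le_sub_left (mul_le_mul_of_nonneg_left hleak hB) _).trans
      (le_periodogram_div h.length_pos hj h.periodic k)
  have hoff : periodogram n k m w ≤ ‖fourierCoeff m p j‖ * (3 / (8 * ν)) +
      B * (l + 5 / 24 * ((ν / g) ^ 2 / g)) := by
    have hleak := sum_Ico_dirichlet_le_harmonic h.radius_pos h.period_pos h.period_lt.le hw.le
    have hmain := h.dirichlet_le_of_two_le hp hw h2
    have hdev := (abs_le.mp (abs_periodogram_sub_le hj h.periodic n k w)).2
    exact (sub_le_iff_le_add'.mp hdev).trans (add_le_add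
      (mul_le_mul_of_nonneg_left hmain (norm_nonneg _)) (mul_le_mul_of_nonneg_left hleak hB))
  have hl : 1 / (2 * (g : ℝ)) ≤ l := by
    have : (1 : ℝ) ≤ harmonic (p / 2) := by exact_mod_cast one_le_harmonic (by lia : 0 < p / 2)
    exact div_le_div_of_nonneg_right this (by positivity)
  have hleak := mul_le_mul_of_nonneg_left
    (add_leakage_le_mul (by exact_mod_cast hg5) h2 hw.le hl) hB
  have hdrop : 3 / (8 * ν) ≤ 3 / 16 := by
    rw [div_le_div_iff₀ (by linarith) (by norm_num)]
    linarith
  have hcoeff := mul_le_mul_of_nonneg_right (h.two_mul_noiseLevel_add_le hp hj hj0)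
    (by linarith : 0 ≤ 1 - 3 / (8 * ν))
  have := mul_le_mul_of_nonneg_left hdrop he.le
  linarith

end QuietArm

/-! ### The search loop -/

section Search

variable {n g : ℕ} {Y : ℝ → ℝ} {D : Set ℝ} {Q S : Finset ℚ} {q : ℚ} {w : ℝ}

/-- What is left of the domain `D` after the frequencies in `S` have been found. -/
def remainingDomain (n g : ℕ) (D : Set ℝ) (S : Finset ℚ) : Set ℝ :=
  D \ ⋃ q ∈ S, Set.Ioo ((q : ℝ) - (g : ℝ) / n) ((q : ℝ) + (g : ℝ) / n)

/-- A set `Q` of candidate frequencies that the search on the domain `D` finds in some order: it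
covers `D` without redundancy, and only a point of `Q` is recorded for a point that beats it. -/
structure Resolves (n g : ℕ) (Y : ℝ → ℝ) (D : Set ℝ) (Q : Finset ℚ) : Prop where
  mem : ∀ q ∈ Q, (q : ℝ) ∈ D
  mem_candidate : ∀ q ∈ Q, q ∈ candidateFrequencies n g
  separated : ∀ q ∈ Q, ∀ r ∈ Q, q ≠ r → (g : ℝ) / n ≤ |(q : ℝ) - r|
  covers : ∀ w ∈ D, ∃ q ∈ Q, |w - q| < g / n
  closest : ∀ q ∈ Q, ∀ w : ℝ, |w - q| < g / n → Y q ≤ Y w → ∀ r ∈ candidateFrequencies n g,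
    |(r : ℝ) - w| ≤ |(q : ℝ) - w| → r = q

theorem finite_candidateFrequencies (n g : ℕ) : (candidateFrequencies n g).Finite := by
  obtain ⟨N, hN⟩ := exists_nat_gt ((n : ℝ) / (2 * g))
  refine ((range N ×ˢ range N).finite_toSet.image fun a : ℕ × ℕ ↦ (a.1 : ℚ) / a.2).subset ?_
  rintro _ ⟨j₁, j₂, -, h12, h2, rfl⟩
  have : j₂ < N := by exact_mod_cast h2.trans hN
  exact ⟨(j₁, j₂), Finset.mk_mem_product (Finset.mem_range.mpr (by lia))
    (Finset.mem_range.mpr this), rfl⟩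

theorem lcmReciprocals_congr {l l' : List ℚ} (h : ∀ q, q ∈ l ↔ q ∈ l') :
    lcmReciprocals l = lcmReciprocals l' := by
  simp only [lcmReciprocals, h]

theorem remainingDomain_empty (n g : ℕ) (D : Set ℝ) : remainingDomain n g D ∅ = D := by
  simp [remainingDomain]

theorem remainingDomain_insert (n g : ℕ) (D : Set ℝ) (q : ℚ) (S : Finset ℚ) :
    remainingDomain n g D (insert q S) =
      remainingDomain n g D S \ Set.Ioo ((q : ℝ) - (g : ℝ) / n) ((q : ℝ) + (g : ℝ) / n) := by
  rw [remainingDomain, Finset.set_biUnion_insert, Set.union_comm, ← Set.sdiff_sdiff,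
    remainingDomain]

theorem mem_remainingDomain :
    w ∈ remainingDomain n g D S ↔ w ∈ D ∧ ∀ q ∈ S, (g : ℝ) / n ≤ |w - q| := by
  simp only [remainingDomain, ← Real.ball_eq_Ioo, Set.mem_sdiff, Set.mem_iUnion, Metric.mem_ball,
    Real.dist_eq, exists_prop, not_exists, not_and, not_lt]

theorem exists_isMaxOn_remainingDomain {σ H : ℝ} (hY : Continuous Y)
    (hne : (remainingDomain n g (initialDomain n g σ H Y) S).Nonempty) :
    ∃ w ∈ remainingDomain n g (initialDomain n g σ H Y) S,
      IsMaxOn Y (remainingDomain n g (initialDomain n g σ H Y) S) w := by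
  obtain ⟨x, ⟨hgx, hx2, hxY⟩, hxS⟩ := hne
  have hcompact : IsCompact (Set.Icc ((g : ℝ) / n) (1 / 2) \
      ⋃ q ∈ S, Set.Ioo ((q : ℝ) - (g : ℝ) / n) ((q : ℝ) + (g : ℝ) / n)) :=
    isCompact_Icc.diff (isOpen_biUnion fun _ _ ↦ isOpen_Ioo)
  obtain ⟨w, ⟨⟨hgw, hw2⟩, hwS⟩, hmax⟩ :=
    hcompact.exists_isMaxOn ⟨x, ⟨hgx, hx2⟩, hxS⟩ hY.continuousOn
  exact ⟨w, ⟨⟨hgw, hw2, hxY.trans_le (hmax ⟨⟨hgx, hx2⟩, hxS⟩)⟩, hwS⟩,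
    fun v hv ↦ hmax ⟨⟨hv.1.1, hv.1.2.1⟩, hv.2⟩⟩

namespace Resolves

theorem mem_remainingDomain_of_notMem (h : Resolves n g Y D Q) (hSQ : S ⊆ Q) (hq : q ∈ Q)
    (hqS : q ∉ S) : (q : ℝ) ∈ remainingDomain n g D S :=
  mem_remainingDomain.mpr ⟨h.mem q hq, fun r hr ↦
    h.separated q hq r (hSQ hr) (ne_of_mem_of_not_mem hr hqS).symm⟩

theorem exists_notMem_of_mem_remainingDomain (h : Resolves n g Y D Q)
    (hw : w ∈ remainingDomain n g D S) : ∃ q ∈ Q, q ∉ S ∧ |w - q| < g / n := by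
  obtain ⟨hwD, hfar⟩ := mem_remainingDomain.mp hw
  obtain ⟨q, hq, hnear⟩ := h.covers w hwD
  exact ⟨q, hq, fun hqS ↦ hnear.not_ge (hfar q hqS), hnear⟩

theorem exists_insert_of_searchStep (h : Resolves n g Y D Q) (hSQ : S ⊆ Q) {s s' : SearchState}
    (hs : s.domain = remainingDomain n g D S) (hstep : SearchStep n g Y s s') :
    ∃ q ∈ Q, q ∉ S ∧ s'.domain = remainingDomain n g D (insert q S) ∧ s'.found = q :: s.found := by
  obtain ⟨w, hw, hmax, r, hr, hmin, hdomain, hfound⟩ := hstep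
  rw [hs] at hw hmax hdomain
  obtain ⟨q, hq, hqS, hnear⟩ := h.exists_notMem_of_mem_remainingDomain hw
  obtain rfl : r = q := h.closest q hq w hnear
    (hmax (h.mem_remainingDomain_of_notMem hSQ hq hqS)) r hr (hmin (h.mem_candidate q hq))
  exact ⟨r, hq, hqS, hdomain.trans (remainingDomain_insert n g D r S).symm, hfound⟩

theorem exists_searchStep (h : Resolves n g Y D Q) {s : SearchState} (hw : w ∈ s.domain)
    (hmax : IsMaxOn Y s.domain w) (hwD : w ∈ D) : ∃ s', SearchStep n g Y s s' := by
  obtain ⟨q₀, hq₀, -⟩ := h.covers w hwD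
  obtain ⟨q, hq, hmin⟩ := Set.exists_min_image (candidateFrequencies n g)
    (fun r : ℚ ↦ |(r : ℝ) - w|) (finite_candidateFrequencies n g) ⟨q₀, h.mem_candidate q₀ hq₀⟩
  exact ⟨⟨_, _⟩, w, hw, hmax, q, hq, hmin, rfl, rfl⟩

theorem alwaysReturns_of_domain_eq (h : Resolves n g Y D Q)
    (hY : ∀ S : Finset ℚ, (remainingDomain n g D S).Nonempty →
      ∃ w ∈ remainingDomain n g D S, IsMaxOn Y (remainingDomain n g D S) w)
    {S : Finset ℚ} (hSQ : S ⊆ Q) {s : SearchState} (hs : s.domain = remainingDomain n g D S)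
    (hfound : ∀ q, q ∈ s.found ↔ q ∈ S) :
    AlwaysReturns n g Y s (lcmReciprocals Q.toList) := by
  rcases hSQ.eq_or_ssubset with rfl | hssub
  · rw [lcmReciprocals_congr (l' := s.found) fun q ↦ by rw [Finset.mem_toList, hfound]]
    refine .halt s (hs.trans (Set.eq_empty_of_forall_notMem fun w hw ↦ ?_))
    obtain ⟨q, hq, hqS, -⟩ := h.exists_notMem_of_mem_remainingDomain hw
    exact hqS hq
  · obtain ⟨q, hq, hqS⟩ := Finset.exists_of_ssubset hssub
    have hne := Set.nonempty_of_mem (h.mem_remainingDomain_of_notMem hSQ hq hqS)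
    obtain ⟨w, hw, hmax⟩ := hY S hne
    refine .step s _ (hs ▸ hne) (h.exists_searchStep (hs ▸ hw) (hs ▸ hmax) hw.1) ?_
    intro s' hstep
    obtain ⟨r, hr, hrS, hs', hfound'⟩ := h.exists_insert_of_searchStep hSQ hs hstep
    have : (Q \ insert r S).card < (Q \ S).card := by
      rw [Finset.sdiff_insert]
      exact Finset.card_erase_lt_of_mem (Finset.mem_sdiff.mpr ⟨hr, hrS⟩)
    refine h.alwaysReturns_of_domain_eq hY (Finset.insert_subset hr hSQ) hs' fun q ↦ ?_
    rw [hfound', List.mem_cons, hfound, Finset.mem_insert]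
termination_by (Q \ S).card

theorem alwaysReturns {σ H : ℝ} (hY : Continuous Y)
    (h : Resolves n g Y (initialDomain n g σ H Y) Q) :
    AlwaysReturns n g Y ⟨initialDomain n g σ H Y, []⟩ (lcmReciprocals Q.toList) :=
  h.alwaysReturns_of_domain_eq (fun _ ↦ exists_isMaxOn_remainingDomain hY) (Finset.empty_subset Q)
    (remainingDomain_empty n g _).symm (by simp)

end Resolves

end Search

/-! ### The least common multiple of the present frequencies -/

/-- The present frequencies `j / p` in `(0, 1 / 2]`. -/
def presentFrequencies (m : ℕ → ℝ) (p : ℕ) : Finset ℚ :=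
  ((Icc 1 (p / 2)).filter fun j : ℕ ↦ fourierCoeff m p j ≠ 0).image fun j : ℕ ↦ (j : ℚ) / p

section Period

variable {m : ℕ → ℝ} {p j : ℕ}

theorem mem_presentFrequencies {q : ℚ} : q ∈ presentFrequencies m p ↔
    ∃ j : ℕ, 1 ≤ j ∧ 2 * j ≤ p ∧ fourierCoeff m p j ≠ 0 ∧ (j : ℚ) / p = q := by
  simp only [presentFrequencies, Finset.mem_image, Finset.mem_filter, Finset.mem_Icc, and_assoc,
    Nat.le_div_iff_mul_le two_pos, mul_comm _ 2]

theorem div_mem_presentFrequencies (hj1 : 1 ≤ j) (hj : 2 * j ≤ p) (hj0 : fourierCoeff m p j ≠ 0) :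
    (j : ℚ) / p ∈ presentFrequencies m p :=
  mem_presentFrequencies.mpr ⟨j, hj1, hj, hj0, rfl⟩

theorem periodic_of_dvd_mul (hp : 0 < p) (hm : Function.Periodic m p) {a : ℕ}
    (ha : ∀ j < p, fourierCoeff m p j ≠ 0 → p ∣ a * j) : Function.Periodic m a := by
  intro t
  have : (p : ℂ) ≠ 0 := by exact_mod_cast hp.ne'
  suffices (m (t + a) : ℂ) = m t by exact_mod_cast this
  rw [fourierCoeff_representation m p hp hm, fourierCoeff_representation m p hp hm]
  refine Finset.sum_congr rfl fun j hj ↦ ?_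
  rcases eq_or_ne (fourierCoeff m p j) 0 with h0 | h0
  · rw [h0, zero_mul, zero_mul]
  obtain ⟨c, hc⟩ := ha j (Finset.mem_range.mp hj) h0
  have hc' : (a * j : ℂ) = p * c := by exact_mod_cast hc
  congr 1
  rw [Complex.exp_eq_exp_iff_exists_int]
  refine ⟨c, ?_⟩
  push_cast
  field_simp
  linear_combination hc'

theorem dvd_mul_of_forall_presentFrequencies (hp : 0 < p) {a : ℕ}
    (ha : ∀ q ∈ presentFrequencies m p, ∃ c : ℕ, (a : ℚ) = c * q⁻¹) (hj : j < p)
    (hj0 : fourierCoeff m p j ≠ 0) : p ∣ a * j := by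
  have lower {i : ℕ} (hi : 2 * i ≤ p) (hi0 : fourierCoeff m p i ≠ 0) : p ∣ a * i := by
    rcases Nat.eq_zero_or_pos i with rfl | hi1
    · exact dvd_zero p
    obtain ⟨c, hc⟩ := ha _ (div_mem_presentFrequencies hi1 hi hi0)
    refine ⟨c, ?_⟩
    rw [inv_div, mul_div_assoc', eq_div_iff (by exact_mod_cast hi1.ne'), mul_comm (c : ℚ)] at hc
    exact_mod_cast hc
  rcases le_total (2 * j) p with h2 | h2
  · exact lower h2 hj0
  · have hsym : fourierCoeff m p (p - j) ≠ 0 := by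
      rw [← norm_ne_zero_iff, norm_fourierCoeff_sub m hp hj.le]
      exact norm_ne_zero_iff.mpr hj0
    refine (Nat.dvd_add_right (lower (by lia) hsym)).mp ⟨a, ?_⟩
    rw [← mul_add, Nat.sub_add_cancel hj.le, mul_comm]

theorem lcmReciprocals_presentFrequencies (h : IsMinimalPeriod m p) :
    lcmReciprocals (presentFrequencies m p).toList = p := by
  obtain ⟨⟨hp, hm⟩, hmin⟩ := h
  simp only [lcmReciprocals, Finset.mem_toList]
  refine IsLeast.csInf_eq ⟨⟨hp, fun q hq ↦ ?_⟩, fun a ⟨ha, haq⟩ ↦ hmin ⟨ha, ?_⟩⟩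
  · obtain ⟨j, hj1, -, -, rfl⟩ := mem_presentFrequencies.mp hq
    have : (j : ℚ) ≠ 0 := by exact_mod_cast (by lia : j ≠ 0)
    exact ⟨j, by rw [inv_div, mul_div_cancel₀ _ this]⟩
  · exact periodic_of_dvd_mul hp hm fun j hj hj0 ↦
      dvd_mul_of_forall_presentFrequencies hp haq hj hj0

end Period

section Separation

theorem one_div_mul_le_abs_sub {a b c d : ℕ} (hb : 0 < b) (hd : 0 < d)
    (hne : (a / b : ℚ) ≠ c / d) : (1 : ℝ) / (b * d) ≤ |(a / b - c / d : ℝ)| := by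
  have : (0 : ℝ) < b := by exact_mod_cast hb
  have : (0 : ℝ) < d := by exact_mod_cast hd
  have hcross : (a * d - b * c : ℤ) ≠ 0 := by
    refine fun h ↦ hne ?_
    rw [div_eq_div_iff (by exact_mod_cast hb.ne') (by exact_mod_cast hd.ne'), mul_comm (c : ℚ)]
    exact_mod_cast sub_eq_zero.mp h
  have hone : (1 : ℝ) ≤ |(a * d - b * c : ℝ)| := by exact_mod_cast Int.one_le_abs hcross
  rw [div_sub_div _ _ (by positivity) (by positivity), abs_div,
    abs_of_pos (by positivity : (0 : ℝ) < b * d)]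
  gcongr

theorem four_mul_mul_lt {n g p r : ℕ} (hng : n ≤ g ^ 2) (hp : 2 * g * p < n)
    (hr : 2 * g * r < n) : 4 * (r * p) < n := by
  by_contra! h
  have hprod : (2 * g * r) * (2 * g * p) < n * n := Nat.mul_lt_mul'' hr hp
  have hsq : n * n ≤ 4 * (r * p) * g ^ 2 := Nat.mul_le_mul h hng
  linarith

theorem eq_div_of_mem_candidateFrequencies {n g p j : ℕ} {q : ℚ} (hg : 0 < g) (hp : 0 < p)
    (hn : 2 * g * p < n) (hng : n ≤ g ^ 2) (hq : q ∈ candidateFrequencies n g)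
    (hclose : n * |(q : ℝ) - j / p| < 4) : q = j / p := by
  obtain ⟨j₁, j₂, hj₁, h12, hj₂, rfl⟩ := hq
  rw [lt_div_iff₀ (by positivity), mul_comm] at hj₂
  by_contra hne
  have hsep := one_div_mul_le_abs_sub (by lia) hp hne
  have : (0 : ℝ) < j₂ * p := by exact_mod_cast Nat.mul_pos (by lia) hp
  have h4 : (4 * (j₂ * p) : ℝ) < n := by
    exact_mod_cast four_mul_mul_lt hng hn (by exact_mod_cast hj₂)
  push_cast at hclose
  rw [div_le_iff₀ (by assumption)] at hsep
  nlinarith [abs_nonneg ((j₁ : ℝ) / j₂ - j / p)]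

end Separation

namespace QuietArm

variable {n g k p j : ℕ} {σ H w : ℝ} {m y : ℕ → ℝ}

theorem div_mem_candidateFrequencies (h : QuietArm n g k p σ H m y) (hj1 : 1 ≤ j)
    (hj : 2 * j ≤ p) : (j : ℚ) / p ∈ candidateFrequencies n g := by
  have : (0 : ℝ) < g := by exact_mod_cast h.radius_pos
  refine ⟨j, p, hj1, by lia, ?_, rfl⟩
  rw [lt_div_iff₀ (by positivity), mul_comm]
  exact_mod_cast h.period_lt

theorem div_le_abs_sub (h : QuietArm n g k p σ H m y) {i : ℕ} (hij : (j / p : ℚ) ≠ i / p) :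
    (g / n : ℝ) ≤ |(j / p - i / p : ℝ)| := by
  have hp : (0 : ℝ) < p := by exact_mod_cast h.period_pos
  have hone : (1 : ℝ) ≤ |(j - i : ℝ)| := by
    have : (j - i : ℤ) ≠ 0 := fun h0 ↦ hij (by rw [show j = i by lia])
    exact_mod_cast Int.one_le_abs this
  have hgp : (g * p : ℝ) ≤ n := by exact_mod_cast (by nlinarith [h.period_lt] : g * p ≤ n)
  rw [← sub_div, abs_div, abs_of_pos hp]
  refine le_trans ?_ (div_le_div_of_nonneg_right hone hp.le)
  rw [div_le_div_iff₀ (by exact_mod_cast h.length_pos) hp, one_mul]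
  exact hgp

theorem resolves (h : QuietArm n g k p σ H m y) :
    Resolves n g (periodogram n k y) (initialDomain n g σ H (periodogram n k y))
      (presentFrequencies m p) := by
  have hn : (0 : ℝ) < n := by exact_mod_cast h.length_pos
  constructor <;> simp only [mem_presentFrequencies]
  case mem =>
    rintro _ ⟨j, hj1, hj, hj0, rfl⟩
    push_cast
    exact h.div_mem_initialDomain hj1 hj hj0
  case mem_candidate =>
    rintro _ ⟨j, hj1, hj, -, rfl⟩
    exact h.div_mem_candidateFrequencies hj1 hj
  case separated =>
    rintro _ ⟨j, -, -, -, rfl⟩ _ ⟨i, -, -, -, rfl⟩ hij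
    push_cast
    exact h.div_le_abs_sub hij
  case covers =>
    intro w hw
    obtain ⟨j, hj1, hj, hj0, hnear⟩ := h.exists_near_of_mem_initialDomain hw
    refine ⟨_, ⟨j, hj1, hj, hj0, rfl⟩, ?_⟩
    push_cast
    rwa [lt_div_iff₀' hn]
  case closest =>
    rintro _ ⟨j, hj1, hj, hj0, rfl⟩ w hnear hle r hr hrw
    push_cast at hnear hle hrw
    rw [lt_div_iff₀' hn] at hnear
    have htwo := h.lt_two_of_periodogram_le (by lia) (by lia) hj0 hnear hle
    refine eq_div_of_mem_candidateFrequencies h.radius_pos h.period_pos h.period_lt h.le_sq hr ?_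
    calc n * |(r : ℝ) - j / p| ≤ n * (|(r : ℝ) - w| + |w - j / p|) := by
          gcongr
          exact abs_sub_le _ _ _
      _ ≤ n * (|w - j / p| + |w - j / p|) := by
          rw [abs_sub_comm w]
          exact mul_le_mul_of_nonneg_left (by linarith) hn.le
      _ < 4 := by linarith

theorem estimatesPeriod (h : QuietArm n g k p σ H m y) : EstimatesPeriod n g σ H k y p := by
  rw [EstimatesPeriod]
  convert h.resolves.alwaysReturns (continuous_periodogram n k y) using 1
  exact (lcmReciprocals_presentFrequencies h.period).symm

end QuietArm

/-! ### Interpolation at roots of unity -/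

section RootsOfUnity

open Polynomial
open scoped ComplexConjugate

variable {M N n : ℕ} {ω z w : ℂ}

/-- The reproducing kernel of the polynomials of degree less than `M` on the unit circle. -/
def szegoKernel (M : ℕ) (z w : ℂ) : ℂ := ∑ t ∈ range M, (z * conj w) ^ t

theorem conj_szegoKernel : conj (szegoKernel M z w) = szegoKernel M w z := by
  simp only [szegoKernel, map_sum, map_pow, map_mul, Complex.conj_conj, mul_comm w]

theorem szegoKernel_self (hz : ‖z‖ = 1) : szegoKernel M z z = M := by
  simp only [szegoKernel, Complex.mul_conj', hz, Complex.ofReal_one, one_pow, Finset.sum_const,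
    Finset.card_range, nsmul_eq_mul, mul_one]

theorem natDegree_sum_C_mul_X_pow_lt (hM : 0 < M) (a : ℕ → ℂ) :
    (∑ t ∈ range M, C (a t) * X ^ t).natDegree < M :=
  (natDegree_sum_le_of_forall_le _ _ fun t ht ↦ (natDegree_C_mul_X_pow_le (a t) t).trans
    (Nat.le_sub_one_of_lt (Finset.mem_range.mp ht))).trans_lt (Nat.sub_one_lt hM.ne')

theorem exists_eval_eq_szegoKernel (hM : 0 < M) (z : ℂ) :
    ∃ q : ℂ[X], q.natDegree < M ∧ ∀ w, q.eval w = szegoKernel M w z := by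
  refine ⟨_, natDegree_sum_C_mul_X_pow_lt hM fun t ↦ conj z ^ t, fun w ↦ ?_⟩
  simp only [szegoKernel, eval_finsetSum, eval_C_mul, eval_X_pow, mul_pow]
  exact Finset.sum_congr rfl fun t _ ↦ mul_comm _ _

theorem sum_pow_mul_conj_pow (hω : IsPrimitiveRoot ω N) {s t : ℕ} (hs : s < N) (ht : t < N) :
    ∑ l ∈ range N, (ω ^ l) ^ s * conj (ω ^ l) ^ t = if s = t then (N : ℂ) else 0 := by
  have : ω ≠ 0 := hω.ne_zero (by lia)
  have hconj : conj ω = ω⁻¹ := (Complex.inv_eq_conj (hω.norm'_eq_one (by lia))).symm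
  set x := ω ^ s * (ω ^ t)⁻¹ with hx
  have hterm (l : ℕ) : (ω ^ l) ^ s * conj (ω ^ l) ^ t = x ^ l := by
    rw [map_pow, hconj, hx]
    ring
  simp_rw [hterm]
  split_ifs with hst
  · simp [hx, hst, this]
  · have hx1 : x ≠ 1 := by
      rw [hx, Ne, mul_inv_eq_one₀ (by positivity)]
      exact fun h ↦ hst (hω.pow_inj hs ht h)
    have hxN : x ^ N = 1 := by
      rw [hx, mul_pow, inv_pow, pow_right_comm, pow_right_comm ω t, hω.pow_eq_one]
      simp
    rw [geom_sum_eq hx1, hxN, sub_self, zero_div]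

theorem sum_eval_mul_szegoKernel (hω : IsPrimitiveRoot ω N) (hM : M ≤ N) {q : ℂ[X]}
    (hq : q.natDegree < M) (z : ℂ) :
    ∑ l ∈ range N, q.eval (ω ^ l) * szegoKernel M z (ω ^ l) = N * q.eval z := by
  have horth {s t : ℕ} (hs : s ∈ range M) (ht : t ∈ range M) :
      ∑ l ∈ range N, q.coeff s * z ^ t * ((ω ^ l) ^ s * conj (ω ^ l) ^ t) =
        if s = t then N * (q.coeff s * z ^ s) else 0 := by
    rw [← Finset.mul_sum, sum_pow_mul_conj_pow hω ((Finset.mem_range.mp hs).trans_le hM)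
      ((Finset.mem_range.mp ht).trans_le hM)]
    split_ifs with hst
    · rw [hst, mul_comm]
    · rw [mul_zero]
  calc ∑ l ∈ range N, q.eval (ω ^ l) * szegoKernel M z (ω ^ l)
      = ∑ l ∈ range N, ∑ s ∈ range M, ∑ t ∈ range M,
          q.coeff s * z ^ t * ((ω ^ l) ^ s * conj (ω ^ l) ^ t) := by
        refine Finset.sum_congr rfl fun l _ ↦ ?_
        rw [eval_eq_sum_range' hq, szegoKernel, Finset.sum_mul_sum]
        refine Finset.sum_congr rfl fun s _ ↦ Finset.sum_congr rfl fun t _ ↦ ?_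
        ring
    _ = ∑ s ∈ range M, ∑ t ∈ range M, if s = t then N * (q.coeff s * z ^ s) else 0 := by
        rw [Finset.sum_comm]
        refine Finset.sum_congr rfl fun s hs ↦ ?_
        rw [Finset.sum_comm]
        exact Finset.sum_congr rfl fun t ht ↦ horth hs ht
    _ = N * q.eval z := by
        rw [eval_eq_sum_range' hq, Finset.mul_sum]
        refine Finset.sum_congr rfl fun s hs ↦ ?_
        rw [Finset.sum_ite_eq, if_pos hs]

theorem sum_norm_szegoKernel_sq (hω : IsPrimitiveRoot ω N) (hM0 : 0 < M) (hM : M ≤ N)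
    (hz : ‖z‖ = 1) : ∑ l ∈ range N, ‖szegoKernel M z (ω ^ l)‖ ^ 2 = N * M := by
  obtain ⟨q, hq, hqw⟩ := exists_eval_eq_szegoKernel hM0 z
  have h := sum_eval_mul_szegoKernel hω hM hq z
  simp only [hqw, szegoKernel_self hz, ← conj_szegoKernel (z := z), Complex.conj_mul'] at h
  exact_mod_cast h

-- The kernel of degree `N` reproduces `f` times the conjugate kernel of degree `N + 1 - n`, whose
-- value at `z` is `N + 1 - n`.
theorem mul_norm_eval_le_sum (hω : IsPrimitiveRoot ω N) {f : ℂ[X]} (hf : f.natDegree < n)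
    (hnN : n ≤ N) (hz : ‖z‖ = 1) :
    N * ((N + 1 - n : ℕ) * ‖f.eval z‖) ≤ ∑ l ∈ range N, ‖f.eval (ω ^ l)‖ *
      (‖szegoKernel N z (ω ^ l)‖ * ‖szegoKernel (N + 1 - n) z (ω ^ l)‖) := by
  obtain ⟨q, hq, hqw⟩ := exists_eval_eq_szegoKernel (M := N + 1 - n) (by lia) z
  have hdeg : (f * q).natDegree < N := natDegree_mul_le.trans_lt (by lia)
  have h := congrArg norm (sum_eval_mul_szegoKernel hω le_rfl hdeg z)
  rw [eval_mul, hqw, szegoKernel_self hz, norm_mul, norm_mul, Complex.norm_natCast,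
    Complex.norm_natCast] at h
  rw [mul_comm ((N + 1 - n : ℕ) : ℝ), ← h]
  refine norm_sum_le_of_le _ fun l _ ↦ le_of_eq ?_
  rw [eval_mul, hqw, ← conj_szegoKernel, norm_mul, norm_mul, RCLike.norm_conj]
  ring

theorem mul_norm_eval_sq_le (hω : IsPrimitiveRoot ω N) {f : ℂ[X]} (hf : f.natDegree < n)
    (hnN : n ≤ N) (hz : ‖z‖ = 1) {R : ℝ} (hR : ∀ l < N, ‖f.eval (ω ^ l)‖ ≤ R) :
    (N + 1 - n) * ‖f.eval z‖ ^ 2 ≤ N * R ^ 2 := by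
  set M := N + 1 - n with hM
  have hMN : (M : ℝ) = N + 1 - n := by rw [hM, Nat.cast_sub (by lia)]; push_cast; ring
  have : (0 : ℝ) < N := by exact_mod_cast (by lia : 0 < N)
  have : (0 : ℝ) < M := by exact_mod_cast (by lia : 0 < M)
  have hle : N * (M * ‖f.eval z‖) ≤
      R * ∑ l ∈ range N, ‖szegoKernel N z (ω ^ l)‖ * ‖szegoKernel M z (ω ^ l)‖ := by
    rw [Finset.mul_sum]
    refine (mul_norm_eval_le_sum hω hf hnN hz).trans (Finset.sum_le_sum fun l hl ↦ ?_)
    exact mul_le_mul_of_nonneg_right (hR l (Finset.mem_range.mp hl)) (by positivity)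
  have hcs := Finset.sum_mul_sq_le_sq_mul_sq (range N) (fun l ↦ ‖szegoKernel N z (ω ^ l)‖)
    fun l ↦ ‖szegoKernel M z (ω ^ l)‖
  rw [sum_norm_szegoKernel_sq hω (by lia) le_rfl hz,
    sum_norm_szegoKernel_sq hω (by lia) (by lia) hz] at hcs
  rw [← hMN]
  refine le_of_mul_le_mul_left ?_ (by positivity : (0 : ℝ) < N ^ 2 * M)
  calc N ^ 2 * M * (M * ‖f.eval z‖ ^ 2) = (N * (M * ‖f.eval z‖)) ^ 2 := by ring
    _ ≤ (R * ∑ l ∈ range N, ‖szegoKernel N z (ω ^ l)‖ * ‖szegoKernel M z (ω ^ l)‖) ^ 2 := by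
        gcongr
    _ ≤ R ^ 2 * (N * N * (N * M)) := by
        rw [mul_pow]
        gcongr
    _ = N ^ 2 * M * (N * R ^ 2) := by ring

end RootsOfUnity

section Grid

open Polynomial

variable {n k L : ℕ} {f : ℕ → ℂ}

/-- The generating polynomial of the observations of an arm, with the first epoch in degree `0`. -/
def epochPolynomial (n k : ℕ) (f : ℕ → ℂ) : ℂ[X] := ∑ i ∈ range n, C (f (n * k + 1 + i)) * X ^ i

theorem norm_transform_eq_norm_eval (n k : ℕ) (f : ℕ → ℂ) (v : ℝ) :
    ‖transform n k f v‖ =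
      1 / n * ‖(epochPolynomial n k f).eval (Complex.exp (-(2 * π * Complex.I * v)))‖ := by
  have hterm (i : ℕ) : f (n * k + 1 + i) *
      Complex.exp (-(2 * π * Complex.I * v * (n * k + 1 + i : ℕ))) =
      Complex.exp (2 * π * Complex.I * (-v : ℝ) * (n * k + 1 : ℕ)) *
        (f (n * k + 1 + i) * Complex.exp (-(2 * π * Complex.I * v)) ^ i) := by
    rw [← Complex.exp_nat_mul, mul_left_comm, ← Complex.exp_add]
    congr 2
    push_cast
    ring
  rw [transform, sum_Icc_epochs, norm_mul, norm_div, norm_one, Complex.norm_natCast]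
  simp only [hterm, epochPolynomial, eval_finsetSum, eval_C_mul, eval_X_pow]
  rw [← Finset.mul_sum, norm_mul, norm_exp_two_pi_mul, one_mul]

theorem mul_norm_transform_sq_le_of_grid (hn : 0 < n) (hL : 1 ≤ L) {R : ℝ}
    (hR : ∀ l < L * n, ‖transform n k f (l / (L * n : ℕ))‖ ≤ R) (v : ℝ) :
    (L - 1) * ‖transform n k f v‖ ^ 2 ≤ L * R ^ 2 := by
  have : (0 : ℝ) < n := by exact_mod_cast hn
  set F := epochPolynomial n k f
  set z := Complex.exp (-(2 * π * Complex.I * v)) with hz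
  have hω := (Complex.isPrimitiveRoot_exp (L * n) (by positivity)).inv
  have hz1 : ‖z‖ = 1 := by
    rw [hz, ← norm_exp_two_pi_mul (-v) 1]
    congr 2
    push_cast
    ring
  have hgrid (l : ℕ) (hl : l < L * n) :
      ‖F.eval ((Complex.exp (2 * π * Complex.I / (L * n : ℕ)))⁻¹ ^ l)‖ ≤ n * R := by
    have hl' := hR l hl
    rw [norm_transform_eq_norm_eval, one_div_mul_eq_div, div_le_iff₀' (by assumption)] at hl'
    refine (congrArg (fun w ↦ ‖F.eval w‖) ?_).trans_le hl'
    rw [← Complex.exp_neg, ← Complex.exp_nat_mul]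
    congr 1
    push_cast
    ring
  have hle := mul_norm_eval_sq_le hω (natDegree_sum_C_mul_X_pow_lt hn _)
    (Nat.le_mul_of_pos_left n hL) hz1 hgrid
  push_cast at hle
  rw [norm_transform_eq_norm_eval, mul_pow, one_div, inv_pow, mul_left_comm,
    inv_mul_le_iff₀ (by positivity)]
  refine le_of_mul_le_mul_left ?_ (by assumption : (0 : ℝ) < n)
  calc n * ((L - 1) * ‖F.eval z‖ ^ 2) ≤ (L * n + 1 - n) * ‖F.eval z‖ ^ 2 := by
        nlinarith [sq_nonneg ‖F.eval z‖]
    _ ≤ L * n * (n * R) ^ 2 := hle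
    _ = n * (n ^ 2 * (L * R ^ 2)) := by ring

end Grid

/-! ### The noise -/

section Tail

variable {Ω ι : Type*} [MeasurableSpace Ω] {P : Measure Ω} {X : ι → Ω → ℝ} {c : ℝ≥0}
  {s : Finset ι} {r : ℝ}

theorem hasSubgaussianMGF_const_mul_of_abs_le_one {Y : Ω → ℝ} (hY : HasSubgaussianMGF Y c P)
    {a : ℝ} (ha : |a| ≤ 1) : HasSubgaussianMGF (fun ω ↦ a * Y ω) c P := by
  refine ⟨(hY.const_mul a).integrable_exp_mul, fun t ↦ ((hY.const_mul a).mgf_le t).trans ?_⟩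
  rw [Real.exp_le_exp]
  change a ^ 2 * c * t ^ 2 / 2 ≤ c * t ^ 2 / 2
  gcongr
  exact mul_le_of_le_one_left c.coe_nonneg ((sq_le_one_iff_abs_le_one a).mpr ha)

theorem measureReal_le_sum_const_mul_le (hind : iIndepFun X P)
    (hX : ∀ i ∈ s, HasSubgaussianMGF (X i) c P) {a : ι → ℝ} (ha : ∀ i, |a i| ≤ 1) (hr : 0 ≤ r) :
    P.real {ω | r ≤ ∑ i ∈ s, a i * X i ω} ≤ Real.exp (-r ^ 2 / (2 * (s.card * c))) := by
  have h := HasSubgaussianMGF.measure_sum_ge_le_of_iIndepFun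
    (hind.comp (fun i x ↦ a i * x) fun i ↦ measurable_const_mul (a i)) (c := fun _ ↦ c)
    (fun i hi ↦ hasSubgaussianMGF_const_mul_of_abs_le_one (hX i hi) (ha i)) hr
  simpa only [Function.comp_apply, Finset.sum_const, nsmul_eq_mul, NNReal.coe_mul,
    NNReal.coe_natCast] using h

theorem measureReal_le_abs_sum_const_mul_le (hind : iIndepFun X P)
    (hX : ∀ i ∈ s, HasSubgaussianMGF (X i) c P) {a : ι → ℝ} (ha : ∀ i, |a i| ≤ 1) (hr : 0 ≤ r) :
    P.real {ω | r ≤ |∑ i ∈ s, a i * X i ω|} ≤ 2 * Real.exp (-r ^ 2 / (2 * (s.card * c))) := by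
  have hneg := measureReal_le_sum_const_mul_le hind hX (a := fun i ↦ -a i)
    (fun i ↦ (abs_neg (a i)).trans_le (ha i)) hr
  simp only [neg_mul, Finset.sum_neg_distrib] at hneg
  simp only [le_abs, Set.ofPred_or, two_mul (Real.exp _)]
  exact (measureReal_union_le _ _).trans
    (add_le_add (measureReal_le_sum_const_mul_le hind hX ha hr) hneg)

theorem measureReal_le_norm_sum_mul_le [IsFiniteMeasure P] (hind : iIndepFun X P)
    (hX : ∀ i ∈ s, HasSubgaussianMGF (X i) c P) {w : ι → ℂ} (hw : ∀ i, ‖w i‖ ≤ 1) (hr : 0 ≤ r) :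
    P.real {ω | r ≤ ‖∑ i ∈ s, w i * X i ω‖} ≤ 4 * Real.exp (-r ^ 2 / (4 * (s.card * c))) := by
  have hsub : {ω | r ≤ ‖∑ i ∈ s, w i * X i ω‖} ⊆
      {ω | r / √2 ≤ |∑ i ∈ s, (w i).re * X i ω|} ∪
        {ω | r / √2 ≤ |∑ i ∈ s, (w i).im * X i ω|} := by
    intro ω hω
    have h := hω.trans (Complex.norm_le_sqrt_two_mul_max _)
    simp only [Complex.re_sum, Complex.im_sum, Complex.re_mul_ofReal, Complex.im_mul_ofReal] at h
    rw [← div_le_iff₀' (by positivity)] at h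
    exact le_max_iff.mp h
  have hexp : -(r / √2) ^ 2 / (2 * (s.card * c)) = -r ^ 2 / (4 * (s.card * c)) := by
    rw [div_pow, Real.sq_sqrt zero_le_two]
    ring
  have hre := measureReal_le_abs_sum_const_mul_le hind hX (a := fun i ↦ (w i).re)
    (fun i ↦ (Complex.abs_re_le_norm _).trans (hw i)) (by positivity : 0 ≤ r / √2)
  have him := measureReal_le_abs_sum_const_mul_le hind hX (a := fun i ↦ (w i).im)
    (fun i ↦ (Complex.abs_im_le_norm _).trans (hw i)) (by positivity : 0 ≤ r / √2)
  rw [hexp] at hre him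
  have hunion := (measureReal_mono (μ := P) hsub).trans (measureReal_union_le _ _)
  linarith

end Tail

section Grid

variable {n k : ℕ} {σ H : ℝ}

/-- The level that the transform of the noise stays below on the grid of `50 * n` frequencies. -/
def gridLevel (n : ℕ) (σ H : ℝ) : ℝ := 5 / 3 * σ * H * √(Real.log n / n)

theorem gridLevel_pos (hn : 2 ≤ n) (hσ : 0 < σ) (hH : 0 < H) : 0 < gridLevel n σ H := by
  have : (1 : ℝ) < n := by exact_mod_cast hn
  have : 0 < √(Real.log n / n) := Real.sqrt_pos.mpr (div_pos (Real.log_pos this) (by linarith))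
  unfold gridLevel
  positivity

theorem gridLevel_le_noiseLevel (hR : 0 ≤ gridLevel n σ H) :
    36 / 35 * gridLevel n σ H ≤ 3 / 4 * noiseLevel n σ H := by
  have hlevel : noiseLevel n σ H = 6 / 5 * gridLevel n σ H / (1 - π / 24) := by
    rw [noiseLevel, gridLevel]
    ring
  have : 8 / 7 * (6 / 5 * gridLevel n σ H) ≤ noiseLevel n σ H := by
    rw [hlevel, le_div_iff₀ (by linarith [Real.pi_le_four])]
    nlinarith [Real.pi_gt_three]
  linarith

theorem norm_transform_lt_of_grid (hn : 0 < n) {f : ℕ → ℂ} (hR : 0 < gridLevel n σ H)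
    (hf : ∀ l < 50 * n, ‖transform n k f (l / (50 * n : ℕ))‖ ≤ gridLevel n σ H) (v : ℝ) :
    ‖transform n k f v‖ < 3 / 4 * noiseLevel n σ H := by
  refine lt_of_lt_of_le ?_ (gridLevel_le_noiseLevel hR.le)
  have hgrid := mul_norm_transform_sq_le_of_grid hn (by norm_num) hf v
  refine lt_of_pow_lt_pow_left₀ 2 (by positivity) ?_
  push_cast at hgrid
  nlinarith

theorem exp_neg_sq_gridLevel (hn : 2 ≤ n) (hσ : σ ≠ 0) :
    Real.exp (-(n * gridLevel n σ H) ^ 2 / (4 * (n * σ ^ 2))) =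
      (n : ℝ) ^ (-(25 / 36 * H ^ 2)) := by
  have : (1 : ℝ) < n := by exact_mod_cast hn
  have : 0 < Real.log n := Real.log_pos this
  rw [Real.rpow_def_of_pos (by linarith), gridLevel]
  congr 1
  rw [mul_pow, mul_pow, Real.sq_sqrt (by positivity)]
  field_simp
  ring

end Grid

section LoudEvent

variable {Ω : Type*} {K T n k : ℕ} {ε : ℕ → Ω → ℝ} {R : ℝ}

/-- The event that, for one of the first `K` arms, the transform of the noise reaches the level `R`
at one of the `50 * n` frequencies `l / (50 * n)`. -/
def loudEvent (ε : ℕ → Ω → ℝ) (K n : ℕ) (R : ℝ) : Set Ω :=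
  ⋃ k ∈ range K, ⋃ l ∈ range (50 * n),
    {ω | R ≤ ‖transform n k (fun s ↦ ε s ω) (l / (50 * n : ℕ))‖}

theorem norm_transform_lt_of_notMem_loudEvent {ω : Ω} (hω : ω ∉ loudEvent ε K n R) (hk : k < K)
    {l : ℕ} (hl : l < 50 * n) : ‖transform n k (fun s ↦ ε s ω) (l / (50 * n : ℕ))‖ < R := by
  simp only [loudEvent, Set.mem_iUnion, Finset.mem_range, Set.mem_ofPred_eq, not_exists,
    not_le] at hω
  exact hω k hk l hl

theorem epochs_subset (hT : n * K ≤ T) (hk : k < K) :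
    Icc (n * k + 1) (n * (k + 1)) ⊆ Icc 1 T :=
  Finset.Icc_subset_Icc (Nat.le_add_left _ _) ((Nat.mul_le_mul_left n hk).trans hT)

variable [MeasurableSpace Ω] {P : Measure Ω} {σ : ℝ≥0} {H : ℝ}

theorem SubGaussianNoise.measurableSet_loudEvent (hε : SubGaussianNoise P T σ ε)
    (hT : n * K ≤ T) : MeasurableSet (loudEvent ε K n R) := by
  refine Finset.measurableSet_biUnion _ fun k hk ↦ Finset.measurableSet_biUnion _ fun l _ ↦
    measurableSet_le measurable_const (Measurable.norm (.const_mul ?_ _))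
  refine Finset.measurable_sum _ fun s hs ↦ .mul_const (Complex.measurable_ofReal.comp ?_) _
  exact hε.measurable s (epochs_subset hT (Finset.mem_range.mp hk) hs)

theorem SubGaussianNoise.measureReal_le_norm_transform_le [IsFiniteMeasure P]
    (hε : SubGaussianNoise P T σ ε) (hn : 0 < n) (hT : n * K ≤ T) (hk : k < K) (hR : 0 ≤ R)
    (v : ℝ) : P.real {ω | R ≤ ‖transform n k (fun s ↦ ε s ω) v‖} ≤
      4 * Real.exp (-(n * R) ^ 2 / (4 * (n * σ ^ 2))) := by
  have : (0 : ℝ) < n := by exact_mod_cast hn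
  set I := Icc (n * k + 1) (n * (k + 1)) with hI
  have hIT : I ⊆ Icc 1 T := epochs_subset hT hk
  have hcard : I.card = n := by rw [hI, Nat.card_Icc, mul_add]; lia
  have hind : iIndepFun (fun s : I ↦ ε s) P := hε.indep.precomp (Set.inclusion_injective hIT)
  have htail := measureReal_le_norm_sum_mul_le hind (s := Finset.univ)
    (fun s _ ↦ hε.subGaussian s (hIT s.2))
    (w := fun s ↦ Complex.exp (2 * π * Complex.I * (-v : ℝ) * (s : ℕ)))
    (fun s ↦ (norm_exp_two_pi_mul _ _).le) (by positivity : 0 ≤ n * R)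
  have hnorm (ω : Ω) : R ≤ ‖transform n k (fun s ↦ ε s ω) v‖ ↔
      n * R ≤ ‖∑ s : I, Complex.exp (2 * π * Complex.I * (-v : ℝ) * (s : ℕ)) * ε s ω‖ := by
    rw [transform, norm_mul, norm_div, norm_one, Complex.norm_natCast, one_div_mul_eq_div,
      le_div_iff₀' (by assumption), ← Finset.sum_coe_sort I]
    refine iff_of_eq (congrArg (fun z : ℂ ↦ n * R ≤ ‖z‖) (Finset.sum_congr rfl fun s _ ↦ ?_))
    rw [mul_comm]
    congr 2
    push_cast
    ring
  simp only [hnorm]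
  simpa only [Finset.card_univ, Fintype.card_coe, hcard, NNReal.coe_pow] using htail

theorem SubGaussianNoise.measureReal_loudEvent_le [IsFiniteMeasure P]
    (hε : SubGaussianNoise P T σ ε) (hσ : 0 < σ) (hH : 0 < H) (hn : 2 ≤ n) (hT : n * K ≤ T) :
    P.real (loudEvent ε K n (gridLevel n σ H)) ≤ 200 * K / (n : ℝ) ^ (0.694 * H ^ 2 - 1) := by
  have : (1 : ℝ) < n := by exact_mod_cast hn
  have hR := gridLevel_pos hn (NNReal.coe_pos.mpr hσ) hH
  have hpow : n * (n : ℝ) ^ (-(25 / 36 * H ^ 2)) ≤ ((n : ℝ) ^ (0.694 * H ^ 2 - 1))⁻¹ := by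
    rw [← Real.rpow_neg (by linarith), mul_comm, ← Real.rpow_add_one (by linarith)]
    exact Real.rpow_le_rpow_of_exponent_le (by linarith) (by nlinarith [sq_nonneg H])
  calc P.real (loudEvent ε K n (gridLevel n σ H))
      ≤ ∑ k ∈ range K, ∑ l ∈ range (50 * n), 4 * (n : ℝ) ^ (-(25 / 36 * H ^ 2)) := by
        refine (measureReal_biUnion_finset_le _ _).trans (Finset.sum_le_sum fun k hk ↦ ?_)
        refine (measureReal_biUnion_finset_le _ _).trans (Finset.sum_le_sum fun l _ ↦ ?_)
        rw [← exp_neg_sq_gridLevel hn (NNReal.coe_ne_zero.mpr hσ.ne')]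
        exact hε.measureReal_le_norm_transform_le (by lia) hT (Finset.mem_range.mp hk) hR.le _
    _ = 200 * K * (n * (n : ℝ) ^ (-(25 / 36 * H ^ 2))) := by
        simp only [Finset.sum_const, Finset.card_range, nsmul_eq_mul]
        push_cast
        ring
    _ ≤ 200 * K / (n : ℝ) ^ (0.694 * H ^ 2 - 1) := by
        rw [div_eq_mul_inv]
        exact mul_le_mul_of_nonneg_left hpow (by positivity)

end LoudEvent

section PeriodCondition

variable {K T n g : ℕ} {p : Fin K → ℕ}

theorem PeriodCondition.two_mul_mul_lt (h : PeriodCondition K T n g p) (k : Fin K) :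
    2 * g * p k < n := by
  have : 0 < g := two_pos.trans_le h.two_le
  have hk := h.period_lt k
  rw [lt_div_iff₀' (by positivity)] at hk
  exact_mod_cast hk

theorem PeriodCondition.two_le_length (h : PeriodCondition K T n g p) {k : Fin K}
    (hk : 0 < p k) : 2 ≤ n := by
  have := Nat.mul_le_mul (Nat.mul_le_mul_left 2 h.two_le) hk
  have := h.two_mul_mul_lt k
  lia

theorem PeriodCondition.le_sq (h : PeriodCondition K T n g p) : n ≤ g ^ 2 := by
  exact_mod_cast (Real.sqrt_le_iff.mp h.sqrt_le).2

end PeriodCondition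

theorem compl_loudEvent_subset_correctEvent {Ω : Type*} {K T n g : ℕ} {σ H : ℝ}
    {μ : Fin K → ℕ → ℝ} {p : Fin K → ℕ} {ε : ℕ → Ω → ℝ} (hσ : 0 < σ) (hH : 0 < H)
    (hp : ∀ k, IsMinimalPeriod (μ k) (p k)) (hperiod : PeriodCondition K T n g p)
    (hmag : ∀ k, MagnitudeCondition n g σ H (μ k) (p k)) :
    (loudEvent ε K n (gridLevel n σ H))ᶜ ⊆ correctEvent n g σ H μ ε p := by
  intro ω hω k
  have hn := hperiod.two_le_length (hp k).1.1
  refine QuietArm.estimatesPeriod ⟨hperiod.two_le, hperiod.le_sq, hp k, hperiod.two_mul_mul_lt k,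
    hmag k, fun v ↦ ?_⟩
  simp only [reward, Complex.ofReal_add, add_sub_cancel_left]
  exact norm_transform_lt_of_grid (by lia) (gridLevel_pos hn hσ hH)
    (fun l hl ↦ (norm_transform_lt_of_notMem_loudEvent hω k.2 hl).le) v

end

end PeriodicBandit

theorem theorem2 {Ω : Type*} [MeasurableSpace Ω] (P : MeasureTheory.Measure Ω)
    [MeasureTheory.IsProbabilityMeasure P]
    (K T n g : ℕ) (H : ℝ) (hH : 0 < H) (σ : ℝ≥0) (hσ : 0 < σ)
    (μ : Fin K → ℕ → ℝ) (p : Fin K → ℕ)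
    (hp : ∀ k, PeriodicBandit.IsMinimalPeriod (μ k) (p k))
    (ε : ℕ → Ω → ℝ) (hε : PeriodicBandit.SubGaussianNoise P T σ ε)
    (hperiod : PeriodicBandit.PeriodCondition K T n g p)
    (hT : n * K ≤ T)
    (hmag : ∀ k, PeriodicBandit.MagnitudeCondition n g σ H (μ k) (p k)) :
    ∃ E : Set Ω, MeasurableSet E ∧
      E ⊆ PeriodicBandit.correctEvent n g σ H μ ε p ∧
      1 - 48 * K / (n : ℝ) ^ (H ^ 2 - 1) - 200 * K / (n : ℝ) ^ (0.867 * H ^ 2 - 1)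
          - 200 * K / (n : ℝ) ^ (0.694 * H ^ 2 - 1) ≤ P.real E := by
  open PeriodicBandit in
  rcases K.eq_zero_or_pos with rfl | hK
  · exact ⟨Set.univ, MeasurableSet.univ, fun ω _ k ↦ k.elim0, by simp⟩
  have hn : 2 ≤ n := hperiod.two_le_length (hp ⟨0, hK⟩).1.1
  have hmeas := hε.measurableSet_loudEvent hT (R := gridLevel n σ H)
  refine ⟨_, hmeas.compl, compl_loudEvent_subset_correctEvent hσ hH hp hperiod hmag, ?_⟩
  rw [MeasureTheory.probReal_compl_eq_one_sub hmeas]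
  have hloud := hε.measureReal_loudEvent_le hσ hH hn hT
  have : 0 ≤ 48 * K / (n : ℝ) ^ (H ^ 2 - 1) := by positivity
  have : 0 ≤ 200 * K / (n : ℝ) ^ (0.867 * H ^ 2 - 1) := by positivity
  linarith
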